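/- \textbf{Theorem (Existence of global minimisers).} Let $n\ge 1$, let $\Omega\subseteq\mathbb{R}^n$ be open and bounded with Lipschitz boundary, let $\mathbb{R}^{n\times n}_{s}$ denote the symmetric real $n\times n$ matrices with the Euclidean (Frobenius) norm, and let $H:\Omega\times\mathbb{R}\times\mathbb{R}^n\times\mathbb{R}^{n\times n}_{s}\to\mathbb{R}$ be a Carath\'eodory function: $H(\cdot,\eta,\mathrm p,X)$ is Lebesgue measurable for all $(\eta,\mathrm p,X)$, and $H(x,\cdot,\cdot,\cdot)$ is continuous for a.e. $x\in\Omega$. Assume the following. (i) (Bounded below) There is $m>0$ with $H\ge -m$; fix any $M>m$. (ii) (Level-convexity) For all $(x,\eta,\mathrm p)\in\Omega\times\mathbb{R}\times\mathbb{R}^n$ and $\tau\in\mathbb{R}$ the set $\{X : H(x,\eta,\mathrm p,X)\le \tau\}$ is convex. (iii) (Coercivity) There are $C_1,C_2>0$ and $0\le s,t<1$ such that $$H(x,\eta,\mathrm p,X)\ \ge\ C_1|X|-C_2\big(1+|\eta|^s+|\mathrm p|^t\big)$$ for a.e. $x\in\Omega$ and all $(\eta,\mathrm p,X)$. (iv)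 (Continuity) For every $R>0$ there are $\ell=\ell(R)>1$ and a continuous increasing (that is, non-decreasing) function $\omega_R$ on $[0,\infty)$ with $\omega_R(0)=0$ such that $$\big|H(x,\eta',\mathrm p',X)-H(x,\eta'',\mathrm p'',X)\big|\ \le\ \omega_R\big(|\eta'-\eta''|+|\mathrm p'-\mathrm p''|\big)\,\big(1+|X|^{\ell}\big)$$ for a.e. $x\in\Omega$, all $\eta',\eta''\in(-R,R)$, all $\mathrm p',\mathrm p''\in\mathbb{R}^n$ with $|\mathrm p'|,|\mathrm p''|<R$, and all $X$. Let $W^{2,\infty}_0(\Omega):=W^{2,\infty}(\Omega)\cap W^{2,1}_0(\Omega)$, where $W^{2,1}_0(\Omega)$ is the closure of $C_c^\infty(\Omega)$ in $W^{2,1}(\Omega)$ (equivalently, $u=0$ and $\mathrm Du=0$ on $\partial\Omega$), and for $g\in W^{2,\infty}(\Omega)$ put $W^{2,\infty}_g(\Omega):=g+W^{2,\infty}_0(\Omega)$. For $u\in W^{2,\infty}(\Omega)$ and $p\in(1,\infty)$ define, with values in $[-\infty,+\infty]$, $$E_\infty(u):=\operatorname*{ess\,sup}_{x\in\Omega}H\big(x,u,\mathrm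 Du,\mathrm D^2u\big),\qquad E_p(u):=\bigg(\frac1{|\Omega|}\int_\Omega\big(M+H(x,u,\mathrm Du,\mathrm D^2u)\big)^p\,\mathrm dx\bigg)^{1/p}-M .$$ Then for every $g\in W^{2,\infty}(\Omega)$ there exists $u_\infty\in W^{2,\infty}_g(\Omega)$ which is a global minimiser of $E_\infty$, that is, $$E_\infty(u_\infty)\le E_\infty(u_\infty+\phi)\qquad\text{for all }\phi\in W^{2,\infty}_0(\Omega).$$ Furthermore, if $E_\infty$ is not identically $+\infty$ on $W^{2,\infty}_g(\Omega)$, then $u_\infty$ is a subsequential weak limit of approximate minimisers of the functionals $E_p$: there are $u_p\in W^{2,\infty}_g(\Omega)$, $p\in(1,\infty)$, with $$E_p(u_p)\ \le\ 2^{-p}+\inf\big\{E_p(v): v\in W^{2,\infty}_g(\Omega)\big\}\qquad\text{for all }p\in(1,\infty),$$ and a sequence $p_j\to\infty$ such that $u_{p_j}\rightharpoonup u_\infty$ weakly in $W^{2,q}(\Omega)$ as $j\to\infty$, for every $q\in(1,\infty)$. -/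

import Mathlib

open MeasureTheory Filter Topology
open scoped ENNReal NNReal

noncomputable section

/-- Euclidean space `ℝⁿ`. -/
abbrev Euc (n : ℕ) : Type := EuclideanSpace ℝ (Fin n)

/-- Symmetric real `n × n` matrices, with the Euclidean (Frobenius) norm. -/
def SymMat (n : ℕ) : Submodule ℝ (EuclideanSpace ℝ (Fin n × Fin n)) where
  carrier := {X | ∀ i j, X (i, j) = X (j, i)}
  add_mem' := by
    intro X Y hX hY i j
    simp [hX i j, hY i j]
  zero_mem' := by
    intro i j
    simp
  smul_mem' := by
    intro c X hX i j
    simp [hX i j]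

/-- Values `(η, p, X)` of a function, its gradient and its Hessian. -/
abbrev Jet (n : ℕ) : Type := ℝ × Euc n × SymMat n

/-- Lipschitz boundary: near each boundary point, in suitable orthogonal coordinates
(the last axis having direction `ν`), the set is the strict epigraph of a Lipschitz function of
the component orthogonal to `ν`. -/
def HasLipschitzBoundary {n : ℕ} (Ω : Set (Euc n)) : Prop :=
  ∀ x₀ ∈ frontier Ω, ∃ r > 0, ∃ ν : Euc n, ‖ν‖ = 1 ∧ ∃ (K : ℝ≥0) (γ : Euc n → ℝ),
    LipschitzWith K γ ∧
      ∀ x ∈ Metric.ball x₀ r, x ∈ Ω ↔ γ (x - inner ℝ ν x • ν) < inner ℝ ν x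

/-- The test functions `C_c^∞(Ω)`. -/
def IsTest {n : ℕ} (Ω : Set (Euc n)) (φ : Euc n → ℝ) : Prop :=
  ContDiff ℝ ((⊤ : ℕ∞) : WithTop ℕ∞) φ ∧ HasCompactSupport φ ∧ tsupport φ ⊆ Ω

/-- The classical partial derivative `∂ᵢ φ`. -/
def partialD {n : ℕ} (i : Fin n) (φ : Euc n → ℝ) (x : Euc n) : ℝ :=
  fderiv ℝ φ x (EuclideanSpace.single i 1)

/-- `w = (u, Du, D²u)` in the sense of weak derivatives on `Ω`. -/
def IsWeakJet {n : ℕ} (Ω : Set (Euc n)) (w : Euc n → Jet n) : Prop :=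
  ∀ φ : Euc n → ℝ, IsTest Ω φ →
    (∀ i, ∫ x in Ω, (w x).1 * partialD i φ x = -∫ x in Ω, (w x).2.1 i * φ x) ∧
    (∀ i j, ∫ x in Ω, (w x).2.1 i * partialD j φ x = -∫ x in Ω, (w x).2.2.1 (i, j) * φ x)

theorem IsTest.partialD_continuous {n : ℕ} {Ω : Set (Euc n)} {φ : Euc n → ℝ} (h : IsTest Ω φ)
    (i : Fin n) : Continuous (partialD i φ) :=
  (h.1.continuous_fderiv (by simp)).clm_apply continuous_const

theorem IsTest.partialD_compact {n : ℕ} {Ω : Set (Euc n)} {φ : Euc n → ℝ} (h : IsTest Ω φ)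
    (i : Fin n) : HasCompactSupport (partialD i φ) :=
  h.2.1.fderiv_apply (𝕜 := ℝ) (EuclideanSpace.single i 1)

/-- Pairing a coordinate of an `L^q` jet with a compactly supported continuous function. -/
theorem integrable_coord {n : ℕ} {Ω : Set (Euc n)} {q : ℝ≥0∞} (hq : 1 ≤ q)
    (w : Lp (Jet n) q (volume.restrict Ω)) (c : Jet n →L[ℝ] ℝ) {ψ : Euc n → ℝ}
    (hψ : Continuous ψ) (hc : HasCompactSupport ψ) :
    Integrable (fun x => c (w x) * ψ x) (volume.restrict Ω) := by
  have h1 : MemLp (fun x => c (w x)) q (volume.restrict Ω) :=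
    c.comp_memLp' (Lp.memLp w)
  exact (h1.locallyIntegrable hq).integrable_smul_right_of_hasCompactSupport hψ hc

theorem integral_coord_add {n : ℕ} {Ω : Set (Euc n)} {q : ℝ≥0∞} (hq : 1 ≤ q)
    (w v : Lp (Jet n) q (volume.restrict Ω)) (c : Jet n →L[ℝ] ℝ) {ψ : Euc n → ℝ}
    (hψ : Continuous ψ) (hc : HasCompactSupport ψ) :
    ∫ x in Ω, c ((w + v : Lp (Jet n) q (volume.restrict Ω)) x) * ψ x =
      (∫ x in Ω, c (w x) * ψ x) + ∫ x in Ω, c (v x) * ψ x := by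
  rw [← integral_add (integrable_coord hq w c hψ hc) (integrable_coord hq v c hψ hc)]
  refine integral_congr_ae ?_
  filter_upwards [Lp.coeFn_add w v] with x hx
  rw [hx, Pi.add_apply, map_add, add_mul]

theorem integral_coord_smul {n : ℕ} {Ω : Set (Euc n)} {q : ℝ≥0∞} (a : ℝ)
    (w : Lp (Jet n) q (volume.restrict Ω)) (c : Jet n →L[ℝ] ℝ) (ψ : Euc n → ℝ) :
    ∫ x in Ω, c ((a • w : Lp (Jet n) q (volume.restrict Ω)) x) * ψ x =
      a * ∫ x in Ω, c (w x) * ψ x := by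
  rw [← integral_const_mul]
  refine integral_congr_ae ?_
  filter_upwards [Lp.coeFn_smul a w] with x hx
  rw [hx, Pi.smul_apply, map_smul, smul_eq_mul, mul_assoc]

theorem integral_coord_zero {n : ℕ} {Ω : Set (Euc n)} {q : ℝ≥0∞} (c : Jet n →L[ℝ] ℝ)
    (ψ : Euc n → ℝ) :
    ∫ x in Ω, c ((0 : Lp (Jet n) q (volume.restrict Ω)) x) * ψ x = 0 := by
  have h := integral_coord_smul (Ω := Ω) (q := q) 0 0 c ψ
  simpa using h

/-- The coordinates `η`, `pᵢ` and `X_{ij}` as continuous linear functionals. -/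
def cVal (n : ℕ) : Jet n →L[ℝ] ℝ := ContinuousLinearMap.fst ℝ ℝ (Euc n × SymMat n)

def cGrad {n : ℕ} (i : Fin n) : Jet n →L[ℝ] ℝ :=
  (EuclideanSpace.proj i).comp
    ((ContinuousLinearMap.fst ℝ (Euc n) (SymMat n)).comp
      (ContinuousLinearMap.snd ℝ ℝ (Euc n × SymMat n)))

def cHess {n : ℕ} (i j : Fin n) : Jet n →L[ℝ] ℝ :=
  (EuclideanSpace.proj (i, j)).comp
    ((SymMat n).subtypeL.comp
      ((ContinuousLinearMap.snd ℝ (Euc n) (SymMat n)).comp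
        (ContinuousLinearMap.snd ℝ ℝ (Euc n × SymMat n))))

/-- The Sobolev space `W^{2,q}(Ω)`, `1 ≤ q ≤ ∞`, an element being recorded as the triple
`(u, Du, D²u)` of the function with its weak gradient and weak Hessian (which it determines),
all in `L^q(Ω)`, and with the `L^q(Ω)` norm of that triple. -/
def W2 {n : ℕ} (Ω : Set (Euc n)) (q : ℝ≥0∞) [hq : Fact (1 ≤ q)] :
    Submodule ℝ (Lp (Jet n) q (volume.restrict Ω)) where
  carrier := {w | IsWeakJet Ω w}
  add_mem' := by
    intro w v hw hv φ hφ
    have hc := hφ.1.continuous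
    refine ⟨fun i => ?_, fun i j => ?_⟩
    · have h1 := integral_coord_add hq.out w v (cVal n) (hφ.partialD_continuous i)
        (hφ.partialD_compact i)
      have h2 := integral_coord_add hq.out w v (cGrad i) hc hφ.2.1
      refine h1.trans (Eq.trans ?_ (congrArg Neg.neg h2).symm)
      rw [neg_add]
      exact congrArg₂ (· + ·) ((hw φ hφ).1 i) ((hv φ hφ).1 i)
    · have h1 := integral_coord_add hq.out w v (cGrad i) (hφ.partialD_continuous j)
        (hφ.partialD_compact j)
      have h2 := integral_coord_add hq.out w v (cHess i j) hc hφ.2.1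
      refine h1.trans (Eq.trans ?_ (congrArg Neg.neg h2).symm)
      rw [neg_add]
      exact congrArg₂ (· + ·) ((hw φ hφ).2 i j) ((hv φ hφ).2 i j)
  zero_mem' := by
    intro φ hφ
    refine ⟨fun i => ?_, fun i j => ?_⟩
    · exact (integral_coord_zero (cVal n) _).trans
        (by rw [← neg_zero]; exact congrArg Neg.neg (integral_coord_zero (cGrad i) φ).symm)
    · exact (integral_coord_zero (cGrad i) _).trans
        (by rw [← neg_zero]; exact congrArg Neg.neg (integral_coord_zero (cHess i j) φ).symm)
  smul_mem' := by
    intro a w hw φ hφ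
    refine ⟨fun i => ?_, fun i j => ?_⟩
    · refine (integral_coord_smul a w (cVal n) _).trans
        (Eq.trans ?_ (congrArg Neg.neg (integral_coord_smul a w (cGrad i) φ)).symm)
      rw [← mul_neg]
      exact congrArg (a * ·) ((hw φ hφ).1 i)
    · refine (integral_coord_smul a w (cGrad i) _).trans
        (Eq.trans ?_ (congrArg Neg.neg (integral_coord_smul a w (cHess i j) φ)).symm)
      rw [← mul_neg]
      exact congrArg (a * ·) ((hw φ hφ).2 i j)

/-- The jet `x ↦ (u(x), Du(x), D²u(x))` of a Sobolev function (an a.e.-class representative). -/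
def jet {n : ℕ} {Ω : Set (Euc n)} {q : ℝ≥0∞} [Fact (1 ≤ q)] (u : W2 Ω q) : Euc n → Jet n :=
  ⇑(u : Lp (Jet n) q (volume.restrict Ω))

/-- `W^{2,1}_0(Ω)`: the closure of `C_c^∞(Ω)` in `W^{2,1}(Ω)`. -/
def W2OneZero {n : ℕ} (Ω : Set (Euc n)) : Set (W2 Ω 1) :=
  closure {u | ∃ φ : Euc n → ℝ, IsTest Ω φ ∧ ∀ᵐ x ∂volume.restrict Ω, (jet u x).1 = φ x}

/-- `W^{2,∞}_0(Ω) = W^{2,∞}(Ω) ∩ W^{2,1}_0(Ω)`; on a bounded Lipschitz set these are the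
`u ∈ W^{2,∞}(Ω)` with `u = 0` and `Du = 0` on `∂Ω`. -/
def W2InfZero {n : ℕ} (Ω : Set (Euc n)) : Set (W2 Ω ∞) :=
  {u | ∃ v ∈ W2OneZero Ω, jet v =ᵐ[volume.restrict Ω] jet u}

/-- The affine class `W^{2,∞}_g(Ω) = g + W^{2,∞}_0(Ω)`. -/
def W2InfAffine {n : ℕ} {Ω : Set (Euc n)} (g : W2 Ω ∞) : Set (W2 Ω ∞) :=
  {u | u - g ∈ W2InfZero Ω}

/-- `u_j ⇀ u` weakly in `W^{2,q}(Ω)`, for functions given in `W^{2,∞}(Ω)` (which is contained in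
`W^{2,q}(Ω)` when `Ω` is bounded): the same functions, seen as elements of `W^{2,q}(Ω)`, converge
in its weak topology. -/
def WeakConvW2 {n : ℕ} {Ω : Set (Euc n)} (q : ℝ≥0∞) [Fact (1 ≤ q)] (u : ℕ → W2 Ω ∞)
    (uLim : W2 Ω ∞) : Prop :=
  ∃ (v : ℕ → W2 Ω q) (vLim : W2 Ω q),
    (∀ j, jet (v j) =ᵐ[volume.restrict Ω] jet (u j)) ∧
    jet vLim =ᵐ[volume.restrict Ω] jet uLim ∧
    Tendsto (fun j => toWeakSpace ℝ (W2 Ω q) (v j)) atTop (𝓝 (toWeakSpace ℝ (W2 Ω q) vLim))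

/-- `H(x, u(x), Du(x), D²u(x))`. -/
def supremand {n : ℕ} {Ω : Set (Euc n)} (H : Euc n → ℝ → Euc n → SymMat n → ℝ) (u : W2 Ω ∞)
    (x : Euc n) : ℝ :=
  H x (jet u x).1 (jet u x).2.1 (jet u x).2.2

/-- The supremal functional `E_∞(u, Ω) = ess sup_Ω H(·, u, Du, D²u)`. -/
def EInf {n : ℕ} {Ω : Set (Euc n)} (H : Euc n → ℝ → Euc n → SymMat n → ℝ) (u : W2 Ω ∞) : EReal :=
  essSup (fun x => (supremand H u x : EReal)) (volume.restrict Ω)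

/-- The modified `L^p` functional
`E_p(u, Ω) = (⨍_Ω (M + H(·, u, Du, D²u))^p)^{1/p} - M`, possibly `+∞`
(it is used where `M + H > 0`). -/
def EPow {n : ℕ} {Ω : Set (Euc n)} (H : Euc n → ℝ → Euc n → SymMat n → ℝ) (M p : ℝ)
    (u : W2 Ω ∞) : EReal :=
  (((⨍⁻ x in Ω, ENNReal.ofReal (M + supremand H u x) ^ p ∂volume) ^ (1 / p) : ℝ≥0∞) : EReal)
    - (M : EReal)

/-- Carathéodory functions on `Ω × (ℝ × ℝⁿ × Sym)`: Lebesgue measurable in `x`, and continuous in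
the remaining variables for almost every `x`. -/
def IsCaratheodory {n : ℕ} (Ω : Set (Euc n)) (H : Euc n → ℝ → Euc n → SymMat n → ℝ) : Prop :=
  (∀ η p X, AEMeasurable (fun x => H x η p X) (volume.restrict Ω)) ∧
  ∀ᵐ x ∂volume.restrict Ω, Continuous fun z : Jet n => H x z.1 z.2.1 z.2.2

/-- `u` is a global minimiser of `E_∞(·, Ω)` in `g + W^{2,∞}_0(Ω)`. -/
def IsGlobalMinimiser {n : ℕ} {Ω : Set (Euc n)} (H : Euc n → ℝ → Euc n → SymMat n → ℝ)
    (g u : W2 Ω ∞) : Prop :=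
  u ∈ W2InfAffine g ∧ ∀ φ ∈ W2InfZero Ω, EInf H u ≤ EInf H (u + φ)

/-- `u` is an approximate minimiser of `E_p(·, Ω)` in `g + W^{2,∞}_0(Ω)`, with tolerance
`2^{-p}`. -/
def IsApproxMinimiser {n : ℕ} {Ω : Set (Euc n)} (H : Euc n → ℝ → Euc n → SymMat n → ℝ)
    (M p : ℝ) (g u : W2 Ω ∞) : Prop :=
  u ∈ W2InfAffine g ∧
    EPow H M p u ≤ (((2 : ℝ) ^ (-p) : ℝ) : EReal) + ⨅ v ∈ W2InfAffine g, EPow H M p v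

end

/-! Suppose some competitor has finite energy. Then `E_p ≤ E_∞` bounds the energies of approximate
minimisers `u_p` uniformly in `p`. Coercivity bounds the Hessian by `M + H` plus an arbitrarily
small multiple of `|η| + |p|`, since the powers `s, t` are below one. The Poincaré inequality in
`W^{2,1}_0` has a constant independent of `p`, so the lower-order terms are absorbed and the jet of
`u_p - g` is bounded in `L^p` by some `B` not depending on `p` (`exists_uniform_bound`).

Along `p = j + 2` a subsequence converges weakly in `L²`, hence in every `L^q` by interpolation
(`ConvWeakly.of_L2`). The limit lies in `W^{2,1}_0`, a closed convex set, and Rellich's theorem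
gives a.e. convergence of values and gradients along a further subsequence. Chebyshev and
Borel–Cantelli turn `L^p` bounds with `p → ∞` into bounds that hold eventually at almost every point
(`ae_eventually_lt_of_lintegral_rpow_le`); in particular the limit belongs to `W^{2,∞}`
(`exists_subseq_weakConvW2`).

Minimality rests on the same device. If `E_∞(v) < c`, then at a.e. `x` the supremand of `u_{p_j}` is
eventually at most `c` plus a small error. Its lower-order arguments can be frozen at their limits,
because the jets are eventually bounded at `x`. What remains is a closed convex constraint on the
Hessian at each `x`, by level-convexity, and such constraints survive weak limits by Hahn–Banach
(`ConvWeakly.ae_mem`). Hence `E_∞(u_∞)` is at most `c` plus a small error.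

If the energy is `+∞` on the whole class, every element is a minimiser. -/

/-! ### Weak sequential convergence and compactness in `L²`. -/

/-- Weak convergence of a sequence in a normed space, tested against the dual. -/
def ConvWeakly {E : Type*} [NormedAddCommGroup E] [NormedSpace ℝ E] (w : ℕ → E) (x : E) : Prop :=
  ∀ l : StrongDual ℝ E, Tendsto (fun j => l (w j)) atTop (𝓝 (l x))

theorem ConvWeakly.comp {E : Type*} [NormedAddCommGroup E] [NormedSpace ℝ E] {w : ℕ → E} {x : E}
    (h : ConvWeakly w x) {k : ℕ → ℕ} (hk : StrictMono k) : ConvWeakly (w ∘ k) x :=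
  fun l => (h l).comp hk.tendsto_atTop

theorem ConvWeakly.map {E F : Type*} [NormedAddCommGroup E] [NormedSpace ℝ E]
    [NormedAddCommGroup F] [NormedSpace ℝ F] {w : ℕ → E} {x : E}
    (h : ConvWeakly w x) (T : E →L[ℝ] F) : ConvWeakly (fun j => T (w j)) (T x) :=
  fun l => h (l.comp T)

theorem ConvWeakly.sub_const {E : Type*} [NormedAddCommGroup E] [NormedSpace ℝ E] {w : ℕ → E}
    {x : E} (h : ConvWeakly w x) (y : E) : ConvWeakly (fun j => w j - y) (x - y) := by
  intro l
  simpa using (h l).sub_const (l y)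

/-- Weak limits of sequences that are frequently in a closed convex set lie in that set. -/
theorem ConvWeakly.mem_of_frequently {E : Type*} [NormedAddCommGroup E] [NormedSpace ℝ E]
    {w : ℕ → E} {x : E} (h : ConvWeakly w x) {C : Set E} (hC : Convex ℝ C) (hC' : IsClosed C)
    (hw : ∃ᶠ j in atTop, w j ∈ C) : x ∈ C := by
  by_contra hx
  obtain ⟨f, u, h1, h2⟩ := geometric_hahn_banach_closed_point hC hC' hx
  have h3 := (h f).eventually (lt_mem_nhds h2)
  obtain ⟨j, hj, hj'⟩ := (hw.and_eventually h3).exists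
  exact absurd (h1 _ hj) (not_lt.2 hj'.le)

/-- The Riesz isomorphism turns weak convergence into weak-* convergence, where the sequential
Banach–Alaoglu theorem applies by separability. -/
theorem exists_convWeakly_of_hilbert {E : Type*} [NormedAddCommGroup E] [InnerProductSpace ℝ E]
    [CompleteSpace E] [TopologicalSpace.SeparableSpace E] (w : ℕ → E) (B : ℝ)
    (hw : ∀ j, ‖w j‖ ≤ B) : ∃ x, ∃ k : ℕ → ℕ, StrictMono k ∧ ConvWeakly (w ∘ k) x := by
  have h := WeakDual.isSeqCompact_closedBall ℝ E (0 : StrongDual ℝ E) B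
  obtain ⟨y, -, k, hk, hy⟩ := h (x := fun j => StrongDual.toWeakDual
    (InnerProductSpace.toDual ℝ E (w j))) (by
      intro j
      simpa using hw j)
  refine ⟨(InnerProductSpace.toDual ℝ E).symm (WeakDual.toStrongDual y), k, hk, fun l => ?_⟩
  have h1 := (WeakDual.eval_continuous (𝕜 := ℝ)
    ((InnerProductSpace.toDual ℝ E).symm l)).continuousAt.tendsto.comp hy
  have key : ∀ z : E, l z = inner ℝ z ((InnerProductSpace.toDual ℝ E).symm l) := by
    intro z
    rw [real_inner_comm, InnerProductSpace.toDual_symm_apply]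
  have h2 : l ((InnerProductSpace.toDual ℝ E).symm (WeakDual.toStrongDual y)) =
      y ((InnerProductSpace.toDual ℝ E).symm l) := by
    rw [key, InnerProductSpace.toDual_symm_apply]
    rfl
  rw [h2]
  refine h1.congr fun j => ?_
  simp only [Function.comp_apply]
  rw [key]
  rfl

theorem exists_convWeakly_L2 {α : Type*} [MeasurableSpace α] {μ : Measure α} [IsSeparable μ]
    {F : Type*} [NormedAddCommGroup F] [NormedSpace ℝ F] [FiniteDimensional ℝ F]
    (w : ℕ → Lp F 2 μ) (B : ℝ) (hw : ∀ j, ‖w j‖ ≤ B) :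
    ∃ x, ∃ k : ℕ → ℕ, StrictMono k ∧ ConvWeakly (w ∘ k) x := by
  -- The jet space carries a product sup norm, so its `L²` is not a Hilbert space. Passing to
  -- Euclidean coordinates and back reduces to the Hilbert case.
  let e : F ≃L[ℝ] EuclideanSpace ℝ (Fin (Module.finrank ℝ F)) :=
    ContinuousLinearEquiv.ofFinrankEq (by simp)
  let T := (e : F →L[ℝ] EuclideanSpace ℝ (Fin (Module.finrank ℝ F))).compLpL 2 μ
  let S := (e.symm : EuclideanSpace ℝ (Fin (Module.finrank ℝ F)) →L[ℝ] F).compLpL 2 μ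
  have hST : ∀ v : Lp F 2 μ, S (T v) = v := by
    intro v
    refine Lp.ext ?_
    filter_upwards [(e.symm : EuclideanSpace ℝ (Fin (Module.finrank ℝ F)) →L[ℝ] F).coeFn_compLpL
      (T v), (e : F →L[ℝ] EuclideanSpace ℝ (Fin (Module.finrank ℝ F))).coeFn_compLpL v]
      with x h1 h2
    rw [h1, h2]
    simp
  have : Fact ((2 : ℝ≥0∞) ≠ ∞) := ⟨by simp⟩
  obtain ⟨y, k, hk, hy⟩ := exists_convWeakly_of_hilbert (fun j => T (w j)) (‖T‖ * B)
    (fun j => (T.le_opNorm _).trans (by gcongr; exact hw j))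
  refine ⟨S y, k, hk, ?_⟩
  have := hy.map S
  refine fun l => (this l).congr fun j => ?_
  simp [hST]

/-! ### Closed convex constraints in `L^p` and weak limits. -/

/-- The inclusion `L^p ⊆ L^q`, `q ≤ p`, on a finite measure space. -/
noncomputable def lpIncl {α : Type*} [MeasurableSpace α] (μ : Measure α) [IsFiniteMeasure μ]
    (F : Type*) [NormedAddCommGroup F] [NormedSpace ℝ F] {p q : ℝ≥0∞} [Fact (1 ≤ p)]
    [Fact (1 ≤ q)] (h : q ≤ p) : Lp F p μ →L[ℝ] Lp F q μ :=
  LinearMap.mkContinuous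
    { toFun := fun f => ((Lp.memLp f).mono_exponent h).toLp f
      map_add' := by
        intro f g
        refine Lp.ext ?_
        filter_upwards [((Lp.memLp (f + g)).mono_exponent h).coeFn_toLp,
          Lp.coeFn_add (((Lp.memLp f).mono_exponent h).toLp f)
            (((Lp.memLp g).mono_exponent h).toLp g),
          ((Lp.memLp f).mono_exponent h).coeFn_toLp, ((Lp.memLp g).mono_exponent h).coeFn_toLp,
          Lp.coeFn_add f g] with x h1 h2 h3 h4 h5
        rw [h1, h2, Pi.add_apply, h3, h4, h5, Pi.add_apply]
      map_smul' := by
        intro c f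
        refine Lp.ext ?_
        filter_upwards [((Lp.memLp (c • f)).mono_exponent h).coeFn_toLp,
          Lp.coeFn_smul c (((Lp.memLp f).mono_exponent h).toLp f),
          ((Lp.memLp f).mono_exponent h).coeFn_toLp,
          Lp.coeFn_smul c f] with x h1 h2 h3 h5
        rw [h1, RingHom.id_apply, h2, Pi.smul_apply, h3, h5, Pi.smul_apply] }
    ((μ Set.univ ^ (1 / q.toReal - 1 / p.toReal)).toReal) (by
      intro f
      have h1 := eLpNorm_le_eLpNorm_mul_rpow_measure_univ h (Lp.aestronglyMeasurable f)
      have hexp : 0 ≤ 1 / q.toReal - 1 / p.toReal := by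
        rcases eq_or_ne p ∞ with rfl | hp
        · simp
        · have hq0 : 0 < q.toReal := ENNReal.toReal_pos
            (zero_lt_one.trans_le (Fact.out : 1 ≤ q)).ne' (ne_top_of_le_ne_top hp h)
          exact sub_nonneg.2 (one_div_le_one_div_of_le hq0 (ENNReal.toReal_mono hp h))
      simp only [LinearMap.coe_mk, AddHom.coe_mk, Lp.norm_toLp]
      rw [Lp.norm_def, mul_comm, ← ENNReal.toReal_mul]
      exact ENNReal.toReal_mono (ENNReal.mul_ne_top (Lp.eLpNorm_ne_top f)
        (ENNReal.rpow_ne_top_of_nonneg hexp (measure_ne_top _ _))) h1)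

theorem coeFn_lpIncl {α : Type*} [MeasurableSpace α] (μ : Measure α) [IsFiniteMeasure μ]
    (F : Type*) [NormedAddCommGroup F] [NormedSpace ℝ F] {p q : ℝ≥0∞} [Fact (1 ≤ p)]
    [Fact (1 ≤ q)] (h : q ≤ p) (f : Lp F p μ) : lpIncl μ F h f =ᵐ[μ] f :=
  ((Lp.memLp f).mono_exponent h).coeFn_toLp

theorem isClosed_setOf_ae_mem {α : Type*} [MeasurableSpace α] {μ : Measure α}
    {F : Type*} [NormedAddCommGroup F] {p : ℝ≥0∞} [Fact (1 ≤ p)] {D : α → Set F}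
    (hD : ∀ᵐ x ∂μ, IsClosed (D x)) : IsClosed {v : Lp F p μ | ∀ᵐ x ∂μ, v x ∈ D x} := by
  refine IsSeqClosed.isClosed fun v w hv hw => ?_
  obtain ⟨k, -, hk⟩ := (tendstoInMeasure_of_tendsto_Lp hw).exists_seq_tendsto_ae
  have hv' : ∀ᵐ x ∂μ, ∀ j, v j x ∈ D x := ae_all_iff.2 hv
  filter_upwards [hD, hk, hv'] with x h1 h2 h3
  exact h1.mem_of_tendsto h2 (Eventually.of_forall fun i => h3 _)

theorem convex_setOf_ae_mem {α : Type*} [MeasurableSpace α] {μ : Measure α}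
    {F : Type*} [NormedAddCommGroup F] [NormedSpace ℝ F] {p : ℝ≥0∞} {D : α → Set F}
    (hD : ∀ᵐ x ∂μ, Convex ℝ (D x)) : Convex ℝ {v : Lp F p μ | ∀ᵐ x ∂μ, v x ∈ D x} := by
  intro v hv w hw a b ha hb hab
  simp only [Set.mem_ofPred_eq] at *
  filter_upwards [hD, hv, hw, Lp.coeFn_add (a • v) (b • w), Lp.coeFn_smul a v,
    Lp.coeFn_smul b w] with x h1 h2 h3 h4 h5 h6
  rw [h4, Pi.add_apply, h5, h6]
  exact h1 h2 h3 ha hb hab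

/-- Pointwise closed convex constraints that hold eventually pass to weak `L^p` limits. -/
theorem ConvWeakly.ae_mem {α : Type*} [MeasurableSpace α] {μ : Measure α}
    {F : Type*} [NormedAddCommGroup F] [NormedSpace ℝ F] {p : ℝ≥0∞} [Fact (1 ≤ p)] {C : α → Set F}
    (hC : ∀ᵐ x ∂μ, Convex ℝ (C x)) (hC' : ∀ᵐ x ∂μ, IsClosed (C x)) {w : ℕ → Lp F p μ}
    {v : Lp F p μ} (h : ConvWeakly w v) (hw : ∀ᵐ x ∂μ, ∀ᶠ j in atTop, w j x ∈ C x) :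
    ∀ᵐ x ∂μ, v x ∈ C x := by
  -- The constraint is imposed only at points where the sequence satisfies it from index `k` on;
  -- elsewhere `D k x` is everything. Then every `w j` with `j ≥ k` obeys `D k` almost everywhere,
  -- and no measurability of `C` is required.
  let D : ℕ → α → Set F := fun k x => {z | (∀ j ≥ k, w j x ∈ C x) → z ∈ C x}
  have hD : ∀ k x, D k x = C x ∨ D k x = Set.univ := by
    intro k x
    by_cases hx : ∀ j ≥ k, w j x ∈ C x
    · left; ext z
      exact ⟨fun h => h hx, fun h _ => h⟩
    · right; ext z
      exact ⟨fun _ => trivial, fun _ h => absurd h hx⟩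
  have key : ∀ k, ∀ᵐ x ∂μ, v x ∈ D k x := by
    intro k
    refine h.mem_of_frequently (C := {v : Lp F p μ | ∀ᵐ x ∂μ, v x ∈ D k x})
      (convex_setOf_ae_mem ?_) (isClosed_setOf_ae_mem ?_) ?_
    · filter_upwards [hC] with x hx
      rcases hD k x with h | h <;> rw [h]
      exacts [hx, convex_univ]
    · filter_upwards [hC'] with x hx
      rcases hD k x with h | h <;> rw [h]
      exacts [hx, isClosed_univ]
    · refine Eventually.frequently ?_
      filter_upwards [eventually_ge_atTop k] with j hj
      exact Eventually.of_forall fun x hx => hx j hj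
  filter_upwards [ae_all_iff.2 key, hw] with x h1 h2
  obtain ⟨k, hk⟩ := eventually_atTop.1 h2
  exact h1 k hk

theorem convex_setOf_eLpNorm_le {α : Type*} [MeasurableSpace α] {μ : Measure α}
    {F : Type*} [NormedAddCommGroup F] [NormedSpace ℝ F] {p r : ℝ≥0∞} (hr : 1 ≤ r) (B : ℝ≥0∞) :
    Convex ℝ {v : Lp F p μ | eLpNorm v r μ ≤ B} := by
  intro v hv w hw a b ha hb hab
  simp only [Set.mem_ofPred_eq] at *
  have h1 : eLpNorm (⇑(a • v + b • w)) r μ ≤ eLpNorm (a • ⇑v) r μ + eLpNorm (b • ⇑w) r μ := by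
    rw [eLpNorm_congr_ae ((Lp.coeFn_add _ _).trans
      ((Lp.coeFn_smul a v).add (Lp.coeFn_smul b w)))]
    exact eLpNorm_add_le ((Lp.aestronglyMeasurable v).const_smul a)
      ((Lp.aestronglyMeasurable w).const_smul b) hr
  refine h1.trans ?_
  rw [eLpNorm_const_smul, eLpNorm_const_smul]
  calc ‖a‖ₑ * eLpNorm v r μ + ‖b‖ₑ * eLpNorm w r μ ≤ ‖a‖ₑ * B + ‖b‖ₑ * B := by gcongr
    _ = B := by
      rw [← add_mul, Real.enorm_eq_ofReal ha, Real.enorm_eq_ofReal hb,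
        ← ENNReal.ofReal_add ha hb, hab, ENNReal.ofReal_one, one_mul]

theorem isClosed_setOf_eLpNorm_le {α : Type*} [MeasurableSpace α] {μ : Measure α}
    {F : Type*} [NormedAddCommGroup F] {p r : ℝ≥0∞} [Fact (1 ≤ p)] (B : ℝ≥0∞) :
    IsClosed {v : Lp F p μ | eLpNorm v r μ ≤ B} := by
  refine IsSeqClosed.isClosed fun v w hv hw => ?_
  obtain ⟨k, -, hk⟩ := (tendstoInMeasure_of_tendsto_Lp hw).exists_seq_tendsto_ae
  exact Lp.eLpNorm_le_of_ae_tendsto (Eventually.of_forall fun i => hv (k i))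
    (fun i => Lp.aestronglyMeasurable _) hk

/-! ### From weak `L²` to weak `L^q` convergence. -/

/-- Interpolation of `L^q` between `L^1` and `L^{2q-1}`. -/
theorem lintegral_rpow_le_interpolate {α : Type*} [MeasurableSpace α] {μ : Measure α}
    {f : α → ℝ≥0∞} (hf : AEMeasurable f μ) {q : ℝ} (hq : 1 ≤ q) :
    ∫⁻ x, f x ^ q ∂μ ≤ (∫⁻ x, f x ∂μ) ^ (1 / 2 : ℝ) * (∫⁻ x, f x ^ (2 * q - 1) ∂μ) ^ (1 / 2 : ℝ) := by
  -- Cauchy–Schwarz for the factorisation `f^q = f^{1/2} · f^{q - 1/2}`.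
  have h := ENNReal.lintegral_mul_le_Lp_mul_Lq μ (p := 2) (q := 2)
    (Real.holderConjugate_iff.2 ⟨by norm_num, by norm_num⟩)
    (hf.pow_const (1 / 2 : ℝ)) (hf.pow_const (q - 1 / 2))
  refine le_trans (le_of_eq (lintegral_congr fun x => ?_)) (h.trans (le_of_eq ?_))
  · rw [Pi.mul_apply, ← ENNReal.rpow_add_of_nonneg _ _ (by norm_num) (by linarith)]
    congr 1; ring
  · congr 2
    · refine lintegral_congr fun x => ?_
      rw [← ENNReal.rpow_mul]; norm_num
    · refine lintegral_congr fun x => ?_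
      rw [← ENNReal.rpow_mul]; congr 1; ring

theorem tendsto_eLpNorm_of_tendsto_of_bounded {α : Type*} [MeasurableSpace α] {μ : Measure α}
    {F : Type*} [NormedAddCommGroup F] {f : ℕ → α → F} (hf : ∀ i, AEStronglyMeasurable (f i) μ)
    (h1 : Tendsto (fun i => eLpNorm (f i) 1 μ) atTop (𝓝 0)) {q : ℝ} (hq : 1 ≤ q) {B : ℝ≥0∞}
    (hB : B ≠ ∞) (h2 : ∀ i, eLpNorm (f i) (ENNReal.ofReal (2 * q - 1)) μ ≤ B) :
    Tendsto (fun i => eLpNorm (f i) (ENNReal.ofReal q) μ) atTop (𝓝 0) := by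
  have e : ∀ i, ∀ s : ℝ, 1 ≤ s → eLpNorm (f i) (ENNReal.ofReal s) μ =
      (∫⁻ x, ‖f i x‖ₑ ^ s ∂μ) ^ (1 / s) := by
    intro i s hs
    rw [eLpNorm_eq_lintegral_rpow_enorm_toReal (by simp; linarith) (by simp),
      ENNReal.toReal_ofReal (by linarith)]
  have h3 : ∀ i, eLpNorm (f i) (ENNReal.ofReal q) μ ≤
      ((eLpNorm (f i) 1 μ) ^ (1 / 2 : ℝ) * (B ^ (2 * q - 1)) ^ (1 / 2 : ℝ)) ^ (1 / q) := by
    intro i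
    rw [e i q hq]
    refine ENNReal.rpow_le_rpow ?_ (by positivity)
    refine (lintegral_rpow_le_interpolate (hf i).enorm hq).trans ?_
    rw [eLpNorm_one_eq_lintegral_enorm]
    gcongr
    have := h2 i
    rw [e i _ (by linarith)] at this
    rwa [one_div, ENNReal.rpow_inv_le_iff (by linarith)] at this
  refine tendsto_of_tendsto_of_tendsto_of_le_of_le tendsto_const_nhds ?_ (fun _ => zero_le) h3
  have hK : (B ^ (2 * q - 1)) ^ (1 / 2 : ℝ) ≠ ∞ :=
    ENNReal.rpow_ne_top_of_nonneg (by norm_num)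
      (ENNReal.rpow_ne_top_of_nonneg (by linarith) hB)
  have t1 : Tendsto (fun i => eLpNorm (f i) 1 μ ^ (1 / 2 : ℝ)) atTop (𝓝 0) := by
    have := (ENNReal.continuous_rpow_const (y := (1 / 2 : ℝ))).continuousAt.tendsto.comp h1
    simpa [Function.comp_def] using this
  have t2 := ENNReal.Tendsto.mul_const t1 (Or.inr hK)
  have := (ENNReal.continuous_rpow_const (y := 1 / q)).continuousAt.tendsto.comp t2
  have hq' : 0 < 1 / q := by positivity
  simpa [Function.comp_def, ENNReal.zero_rpow_of_pos (inv_pos.2 (zero_lt_one.trans_le hq))] using this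

/-- Weak `L^2` convergence together with a bound in `L^{2q-1}` gives weak `L^q` convergence. -/
theorem ConvWeakly.of_L2 {α : Type*} [MeasurableSpace α] {μ : Measure α} [IsFiniteMeasure μ]
    {F : Type*} [NormedAddCommGroup F] [NormedSpace ℝ F] {w : ℕ → Lp F 2 μ} {x : Lp F 2 μ}
    (h : ConvWeakly w x) {q : ℝ} (hq : 1 ≤ q) [Fact (1 ≤ ENNReal.ofReal q)]
    {B : ℝ≥0∞} (hB : B ≠ ∞)
    (hw : ∀ᶠ j in atTop, eLpNorm (w j) (ENNReal.ofReal (2 * q - 1)) μ ≤ B)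
    {v : ℕ → Lp F (ENNReal.ofReal q) μ} {y : Lp F (ENNReal.ofReal q) μ}
    (hv : ∀ j, v j =ᵐ[μ] w j) (hy : y =ᵐ[μ] x) : ConvWeakly v y := by
  set r := ENNReal.ofReal (2 * q - 1) with hr
  have hr1 : 1 ≤ r := by rw [hr]; simp; linarith
  have hqr : ENNReal.ofReal q ≤ r := ENNReal.ofReal_le_ofReal (by linarith)
  have main : ∀ (l : StrongDual ℝ (Lp F (ENNReal.ofReal q) μ)) (δ : ℝ), 0 < δ →
      ∀ᶠ j in atTop, l (v j) < l y + δ := by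
    intro l δ hδ
    by_contra hcon
    rw [not_eventually] at hcon
    -- `K` collects the `L²` functions with the `L^{2q-1}` bound whose `L^q` version violates the
    -- desired inequality for `l`. It is convex, and closed in `L²` because on `L^{2q-1}`-bounded
    -- sets `L²` convergence forces `L^q` convergence. If the inequality failed infinitely often,
    -- the weak limit `x` would lie in `K`. This avoids representing the dual of `L^q`.
    let K : Set (Lp F 2 μ) := {z | eLpNorm z r μ ≤ B ∧ ∃ z' : Lp F (ENNReal.ofReal q) μ,
      z' =ᵐ[μ] z ∧ l y + δ ≤ l z'}
    have hK : x ∈ K := by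
      refine h.mem_of_frequently ?_ ?_ ?_
      · rintro z ⟨hz1, z', hz2, hz3⟩ t ⟨ht1, t', ht2, ht3⟩ a b ha hb hab
        refine ⟨convex_setOf_eLpNorm_le hr1 B hz1 ht1 ha hb hab, a • z' + b • t', ?_, ?_⟩
        · filter_upwards [Lp.coeFn_add (a • z') (b • t'), Lp.coeFn_smul a z', Lp.coeFn_smul b t',
            Lp.coeFn_add (a • z) (b • t), Lp.coeFn_smul a z, Lp.coeFn_smul b t, hz2, ht2]
            with s h1 h2 h3 h4 h5 h6 h7 h8
          rw [h1, h4, Pi.add_apply, Pi.add_apply, h2, h3, h5, h6, Pi.smul_apply, Pi.smul_apply,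
            Pi.smul_apply, Pi.smul_apply, h7, h8]
        · simp only [map_add, map_smul, smul_eq_mul]
          calc l y + δ = a * (l y + δ) + b * (l y + δ) := by rw [← add_mul, hab, one_mul]
            _ ≤ _ := by gcongr
      · refine IsSeqClosed.isClosed fun z t hz ht => ?_
        have ht1 : eLpNorm t r μ ≤ B :=
          (isClosed_setOf_eLpNorm_le B).mem_of_tendsto ht (Eventually.of_forall fun i => (hz i).1)
        have htm : MemLp t r μ := ⟨Lp.aestronglyMeasurable _, ht1.trans_lt hB.lt_top⟩
        have htq := htm.mono_exponent hqr
        refine ⟨ht1, htq.toLp t, htq.coeFn_toLp, ?_⟩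
        choose z' hz' hz'' using fun i => (hz i).2
        have hconv : Tendsto z' atTop (𝓝 (htq.toLp t)) := by
          rw [Lp.tendsto_Lp_iff_tendsto_eLpNorm]
          have e : ∀ i, eLpNorm (⇑(z' i) - ⇑t) (ENNReal.ofReal q) μ =
              eLpNorm (⇑(z i) - ⇑t) (ENNReal.ofReal q) μ := fun i =>
            eLpNorm_congr_ae ((hz' i).sub (ae_eq_refl _))
          simp_rw [e]
          refine tendsto_eLpNorm_of_tendsto_of_bounded (B := B + B)
            (fun i => (Lp.aestronglyMeasurable _).sub (Lp.aestronglyMeasurable _)) ?_ hq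
            (by simp [hB]) ?_
          · have h2 := (Lp.tendsto_Lp_iff_tendsto_eLpNorm' _ _).1 ht
            have h3 := ENNReal.Tendsto.mul_const (b := μ Set.univ ^
              (1 / (1 : ℝ≥0∞).toReal - 1 / (2 : ℝ≥0∞).toReal)) h2 (Or.inr
                (ENNReal.rpow_ne_top_of_nonneg (by norm_num) (measure_ne_top _ _)))
            rw [zero_mul] at h3
            refine tendsto_of_tendsto_of_tendsto_of_le_of_le tendsto_const_nhds h3
              (fun _ => zero_le) fun i => ?_
            exact eLpNorm_le_eLpNorm_mul_rpow_measure_univ (by norm_num)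
              ((Lp.aestronglyMeasurable _).sub (Lp.aestronglyMeasurable _))
          · intro i
            exact (eLpNorm_sub_le (Lp.aestronglyMeasurable _) (Lp.aestronglyMeasurable _) hr1).trans
              (add_le_add (hz i).1 ht1)
        exact ge_of_tendsto ((l.continuous.tendsto _).comp hconv)
          (Eventually.of_forall fun i => hz'' i)
      · refine (hcon.and_eventually hw).mono fun j hj => ⟨hj.2, v j, hv j, not_lt.1 hj.1⟩
    obtain ⟨-, z', hz1, hz2⟩ := hK
    have : z' = y := Lp.ext (hz1.trans hy.symm)
    rw [this] at hz2
    linarith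
  intro l
  rw [Metric.tendsto_atTop']
  intro ε hε
  obtain ⟨N, hN⟩ := eventually_atTop.1 ((main l ε hε).and (main (-l) ε hε))
  refine ⟨N, fun j hj => ?_⟩
  obtain ⟨h1, h2⟩ := hN j hj.le
  simp only [neg_apply] at h2
  rw [Real.dist_eq, abs_lt]
  constructor <;> linarith

/-! ### Segment estimates and Poincaré inequalities in `W^{2,1}_0`. -/

/-- The `i`-th row of the Hessian. -/
def hessRow {n : ℕ} (i : Fin n) (z : Jet n) : Euc n := WithLp.toLp 2 fun j => z.2.2.1 (i, j)

theorem continuous_hessRow {n : ℕ} (i : Fin n) : Continuous (hessRow i) := by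
  unfold hessRow
  refine (PiLp.continuous_toLp 2 _).comp (continuous_pi fun j => ?_)
  exact (cHess i j).continuous

theorem hessRow_sub {n : ℕ} (i : Fin n) (z w : Jet n) :
    hessRow i (z - w) = hessRow i z - hessRow i w := by
  ext j
  simp [hessRow]

theorem norm_hessRow_le {n : ℕ} (i : Fin n) (z : Jet n) : ‖hessRow i z‖ ≤ ‖z.2.2‖ := by
  have h1 : ‖z.2.2‖ = ‖z.2.2.1‖ := rfl
  rw [h1, EuclideanSpace.norm_eq, EuclideanSpace.norm_eq]
  refine Real.sqrt_le_sqrt ?_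
  rw [Fintype.sum_prod_type]
  exact Finset.single_le_sum (f := fun k => ∑ j, ‖z.2.2.1 (k, j)‖ ^ 2)
    (fun k _ => Finset.sum_nonneg fun j _ => sq_nonneg _) (Finset.mem_univ i)

theorem gradient_apply_eq {n : ℕ} (φ : Euc n → ℝ) (x : Euc n) (j : Fin n) :
    gradient φ x j = partialD j φ x := by
  have h : inner ℝ (gradient φ x) (EuclideanSpace.single j (1 : ℝ)) = partialD j φ x := by
    rw [gradient, InnerProductSpace.toDual_symm_apply]
    rfl
  rw [← h, real_inner_comm, EuclideanSpace.inner_single_left]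
  simp

theorem enorm_sub_le_lintegral_gradient {n : ℕ} {φ : Euc n → ℝ} (hφ : ContDiff ℝ 1 φ)
    (x h : Euc n) :
    ‖φ (x + h) - φ x‖ₑ ≤ ‖h‖ₑ * ∫⁻ s in Set.Icc (0 : ℝ) 1, ‖gradient φ (x + s • h)‖ₑ := by
  have hline : ∀ s : ℝ, HasDerivAt (fun s : ℝ => x + s • h) h s := by
    intro s
    simpa using ((hasDerivAt_id s).smul_const h).const_add x
  have hd : ∀ s : ℝ, HasDerivAt (fun s : ℝ => φ (x + s • h)) (fderiv ℝ φ (x + s • h) h) s :=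
    fun s => ((hφ.differentiable one_ne_zero _).hasFDerivAt).comp_hasDerivAt s (hline s)
  have hc : ContDiff ℝ 1 (fun s : ℝ => φ (x + s • h)) :=
    hφ.comp (contDiff_const.add (contDiff_id.smul contDiff_const))
  have h1 := enorm_sub_le_lintegral_deriv_of_contDiffOn_Icc (hc.contDiffOn (s := Set.Icc 0 1))
    zero_le_one
  simp only [one_smul, zero_smul, add_zero] at h1
  refine h1.trans ?_
  rw [← lintegral_const_mul' _ _ enorm_ne_top]
  refine lintegral_mono fun s => ?_
  simp only [(hd s).deriv]
  rw [mul_comm]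
  refine (ContinuousLinearMap.le_opENorm _ _).trans (le_of_eq ?_)
  congr 1
  rw [gradient]
  exact ((InnerProductSpace.toDual ℝ (Euc n)).symm.enorm_map _).symm

/-- Tonelli and translation invariance: averaging over the translates `s • h`, `s ∈ [0, 1]`,
preserves the integral. -/
theorem lintegral_segment {n : ℕ} {g : Euc n → ℝ≥0∞} (hg : Measurable g) (h : Euc n) :
    ∫⁻ x, ∫⁻ s in Set.Icc (0 : ℝ) 1, g (x + s • h) = ∫⁻ x, g x := by
  rw [lintegral_lintegral_swap]
  · simp only [lintegral_add_right_eq_self g]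
    simp
  · refine Measurable.aemeasurable ?_
    exact hg.comp (measurable_fst.add (measurable_snd.smul_const h))

theorem measurable_segment {n : ℕ} {g : Euc n → ℝ≥0∞} (hg : Measurable g) (h : Euc n) :
    Measurable fun x => ∫⁻ s in Set.Icc (0 : ℝ) 1, g (x + s • h) :=
  Measurable.lintegral_prod_right'
    (f := fun p : Euc n × ℝ => g (p.1 + p.2 • h))
    (hg.comp (measurable_fst.add (measurable_snd.smul_const h)))

/-- Difference quotients of `W^{1,1}` limits of smooth functions are controlled by the gradient
along segments. -/
theorem ae_enorm_sub_le_of_approx {n : ℕ} {f : Euc n → ℝ} {G : Euc n → Euc n}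
    (hf : StronglyMeasurable f) (hG : StronglyMeasurable G)
    (H : ∀ ε : ℝ≥0∞, 0 < ε → ∃ φ : Euc n → ℝ, ContDiff ℝ 1 φ ∧ ∫⁻ x, ‖f x - φ x‖ₑ ≤ ε ∧
      ∫⁻ x, ‖G x - gradient φ x‖ₑ ≤ ε) (h : Euc n) :
    ∀ᵐ x, ‖f (x + h) - f x‖ₑ ≤
      ‖h‖ₑ * ∫⁻ s in Set.Icc (0 : ℝ) 1, ‖G (x + s • h)‖ₑ := by
  have hm1 : Measurable fun x => ‖f (x + h) - f x‖ₑ :=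
    ((hf.comp_measurable (measurable_id.add_const h)).sub hf).enorm
  have hm2 := (measurable_segment hG.enorm h).const_mul ‖h‖ₑ
  -- The integrand is a truncated difference, so a zero integral is exactly the claimed inequality
  -- a.e. The factor `2 + ‖h‖ₑ` below counts two errors in the values and one, weighted by `‖h‖ₑ`,
  -- in the gradient.
  have key : ∫⁻ x, (‖f (x + h) - f x‖ₑ -
      ‖h‖ₑ * ∫⁻ s in Set.Icc (0 : ℝ) 1, ‖G (x + s • h)‖ₑ) = 0 := by
    have hK : (2 + ‖h‖ₑ) ≠ ∞ := by simp
    refine le_antisymm (ENNReal.le_of_forall_pos_le_add fun ε hε _ => ?_) zero_le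
    obtain ⟨φ, hφ, h1, h2⟩ := H (ε / (2 + ‖h‖ₑ)) (ENNReal.div_pos (by simpa using hε.ne') hK)
    have hgc : Continuous (gradient φ) :=
      (InnerProductSpace.toDual ℝ (Euc n)).symm.continuous.comp (hφ.continuous_fderiv one_ne_zero)
    have m1 : StronglyMeasurable fun x => f x - φ x := hf.sub hφ.continuous.stronglyMeasurable
    have m2 : StronglyMeasurable fun x => G x - gradient φ x := hG.sub hgc.stronglyMeasurable
    have pt : ∀ x, ‖f (x + h) - f x‖ₑ - ‖h‖ₑ * ∫⁻ s in Set.Icc (0 : ℝ) 1, ‖G (x + s • h)‖ₑ ≤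
        (‖f (x + h) - φ (x + h)‖ₑ + ‖f x - φ x‖ₑ) +
          ‖h‖ₑ * ∫⁻ s in Set.Icc (0 : ℝ) 1, ‖G (x + s • h) - gradient φ (x + s • h)‖ₑ := by
      intro x
      rw [tsub_le_iff_right]
      have e1 : f (x + h) - f x = (f (x + h) - φ (x + h)) - (f x - φ x) + (φ (x + h) - φ x) := by
        ring
      have e2 : ∫⁻ s in Set.Icc (0 : ℝ) 1, ‖gradient φ (x + s • h)‖ₑ ≤
          (∫⁻ s in Set.Icc (0 : ℝ) 1, ‖G (x + s • h) - gradient φ (x + s • h)‖ₑ) +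
          ∫⁻ s in Set.Icc (0 : ℝ) 1, ‖G (x + s • h)‖ₑ := by
        rw [← lintegral_add_left]
        · refine lintegral_mono fun s => ?_
          rw [← enorm_neg (G (x + s • h) - _)]
          refine le_trans (le_of_eq ?_) (enorm_add_le _ _)
          congr 1
          abel
        · exact m2.enorm.comp (measurable_const.add (measurable_id.smul_const h))
      rw [e1, add_assoc, ← mul_add]
      refine (enorm_add_le _ _).trans (add_le_add enorm_sub_le ?_)
      exact (enorm_sub_le_lintegral_gradient hφ x h).trans (by gcongr)
    calc _ ≤ ∫⁻ x, ((‖f (x + h) - φ (x + h)‖ₑ + ‖f x - φ x‖ₑ) +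
          ‖h‖ₑ * ∫⁻ s in Set.Icc (0 : ℝ) 1, ‖G (x + s • h) - gradient φ (x + s • h)‖ₑ) :=
        lintegral_mono pt
      _ = ((∫⁻ x, ‖f x - φ x‖ₑ) + ∫⁻ x, ‖f x - φ x‖ₑ) +
          ‖h‖ₑ * ∫⁻ x, ‖G x - gradient φ x‖ₑ := by
        rw [lintegral_add_right _ ((measurable_segment m2.enorm h).const_mul _),
          lintegral_add_right _ m1.enorm, lintegral_add_right_eq_self (fun x => ‖f x - φ x‖ₑ),
          lintegral_const_mul _ (measurable_segment m2.enorm h), lintegral_segment m2.enorm]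
      _ ≤ (ε / (2 + ‖h‖ₑ) + ε / (2 + ‖h‖ₑ)) + ‖h‖ₑ * (ε / (2 + ‖h‖ₑ)) := by gcongr
      _ = (2 + ‖h‖ₑ) * (ε / (2 + ‖h‖ₑ)) := by ring
      _ = 0 + ε := by rw [ENNReal.mul_div_cancel (by simp) hK, zero_add]
  filter_upwards [(lintegral_eq_zero_iff (hm1.sub hm2)).1 key] with x hx
  exact tsub_eq_zero_iff_le.1 hx

theorem IsTest.isTest_partialD {n : ℕ} {Ω : Set (Euc n)} {φ : Euc n → ℝ} (h : IsTest Ω φ) (i : Fin n) :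
    IsTest Ω (partialD i φ) := by
  refine ⟨?_, h.partialD_compact i, (tsupport_fderiv_apply_subset ℝ _).trans h.2.2⟩
  exact (h.1.fderiv_right (m := ((⊤ : ℕ∞) : WithTop ℕ∞)) (by simp)).clm_apply contDiff_const

/-- Weak gradients of test functions are classical. -/
theorem IsTest.ae_eq_gradient {n : ℕ} {Ω : Set (Euc n)} (hΩ : IsOpen Ω) {φ : Euc n → ℝ}
    (hφ : IsTest Ω φ) {f : Euc n → ℝ} {G : Euc n → Euc n}
    (hG : Integrable G (volume.restrict Ω)) (hf : ∀ᵐ x ∂volume.restrict Ω, f x = φ x)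
    (hw : ∀ ψ, IsTest Ω ψ → ∀ j, ∫ x in Ω, f x * partialD j ψ x = -∫ x in Ω, G x j * ψ x) :
    ∀ᵐ x ∂volume.restrict Ω, G x = gradient φ x := by
  have main : ∀ j, ∀ᵐ x ∂volume.restrict Ω, x ∈ Ω → G x j - partialD j φ x = 0 := by
    intro j
    have hGj : Integrable (fun x => G x j) (volume.restrict Ω) :=
      (EuclideanSpace.proj j : Euc n →L[ℝ] ℝ).integrable_comp hG
    have hφj : Integrable (partialD j φ) (volume.restrict Ω) :=
      ((hφ.partialD_continuous j).integrable_of_hasCompactSupport (hφ.partialD_compact j)).restrict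
    -- Fundamental lemma of the calculus of variations, applied to the difference of the weak and
    -- the classical derivative.
    refine hΩ.ae_eq_zero_of_integral_contDiff_smul_eq_zero
      ((hGj.sub hφj).locallyIntegrable.locallyIntegrableOn Ω) fun ψ h1 h2 h3 => ?_
    have hψ : IsTest Ω ψ := ⟨h1, h2, h3⟩
    have i1 : Integrable (fun x => ψ x * G x j) (volume.restrict Ω) := by
      obtain ⟨C, hC⟩ := h2.exists_bound_of_continuous h1.continuous
      exact hGj.bdd_mul h1.continuous.aestronglyMeasurable (Eventually.of_forall hC)
    have i2 : Integrable (fun x => ψ x * partialD j φ x) (volume.restrict Ω) := by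
      obtain ⟨C, hC⟩ := h2.exists_bound_of_continuous h1.continuous
      exact hφj.bdd_mul h1.continuous.aestronglyMeasurable (Eventually.of_forall hC)
    have e : ∀ u v : Euc n → ℝ, tsupport u ⊆ Ω →
        ∫ x in Ω, u x * v x = ∫ x, u x * v x := by
      intro u v hu
      refine setIntegral_eq_integral_of_forall_compl_eq_zero fun x hx => ?_
      rw [image_eq_zero_of_notMem_tsupport (fun h => hx (hu h)), zero_mul]
    have ibp : ∫ x, ψ x * partialD j φ x = -∫ x, partialD j ψ x * φ x := by
      refine integral_mul_fderiv_eq_neg_fderiv_mul_of_integrable ?_ ?_ ?_ ?_ ?_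
      · exact ((hψ.partialD_continuous j).mul hφ.1.continuous).integrable_of_hasCompactSupport
          ((hψ.partialD_compact j).mul_right)
      · exact (h1.continuous.mul (hφ.partialD_continuous j)).integrable_of_hasCompactSupport
          h2.mul_right
      · exact (h1.continuous.mul hφ.1.continuous).integrable_of_hasCompactSupport h2.mul_right
      · exact fun x _ => (h1.differentiable (by simp)) x
      · exact fun x _ => (hφ.1.differentiable (by simp)) x
    simp only [smul_eq_mul, mul_sub]
    rw [integral_sub i1 i2, e ψ (partialD j φ) h3, ibp, ← e _ φ (hψ.isTest_partialD j).2.2]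
    have h4 := hw ψ hψ j
    have h5 : ∫ x in Ω, f x * partialD j ψ x = ∫ x in Ω, partialD j ψ x * φ x := by
      refine integral_congr_ae ?_
      filter_upwards [hf] with x hx
      rw [hx, mul_comm]
    have h6 : ∫ x in Ω, ψ x * G x j = ∫ x in Ω, G x j * ψ x := by simp_rw [mul_comm]
    rw [← h5, h4, h6]
    ring
  filter_upwards [ae_all_iff.2 main, ae_restrict_mem hΩ.measurableSet] with x h1 h2
  ext j
  rw [gradient_apply_eq]
  exact sub_eq_zero.1 (h1 j h2)

theorem integrable_jet {n : ℕ} {Ω : Set (Euc n)} (u : W2 Ω 1) :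
    Integrable (jet u) (volume.restrict Ω) :=
  memLp_one_iff_integrable.1 (Lp.memLp _)

theorem stronglyMeasurable_jet {n : ℕ} {Ω : Set (Euc n)} {q : ℝ≥0∞} [Fact (1 ≤ q)] (u : W2 Ω q) :
    StronglyMeasurable (jet u) :=
  Lp.stronglyMeasurable _

/-- A 1-Lipschitz coordinate `a` of the jet is controlled by the `W^{2,1}` distance, and outside `Ω`
both zero extensions vanish. This supplies the global approximations required by
`ae_enorm_sub_le_of_approx`. -/
theorem lintegral_indicator_sub_le {n : ℕ} {Ω : Set (Euc n)} (hΩ : IsOpen Ω) {F : Type*}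
    [NormedAddCommGroup F] {a : Jet n → F}
    (ha : ∀ z w : Jet n, ‖a z - a w‖ ≤ ‖z - w‖) {ψ : Euc n → F} (hψ : ∀ x ∉ Ω, ψ x = 0)
    {v u : W2 Ω 1} (hu : ∀ᵐ x ∂volume.restrict Ω, a (jet u x) = ψ x) :
    ∫⁻ x, ‖Ω.indicator (fun x => a (jet v x)) x - ψ x‖ₑ ≤ edist v u := by
  have e : ∀ x, ‖Ω.indicator (fun x => a (jet v x)) x - ψ x‖ₑ =
      Ω.indicator (fun x => ‖a (jet v x) - ψ x‖ₑ) x := by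
    intro x
    by_cases hx : x ∈ Ω
    · simp [hx]
    · simp [hx, hψ x hx]
  simp_rw [e]
  change _ ≤ edist (v : Lp (Jet n) 1 (volume.restrict Ω)) u
  rw [lintegral_indicator hΩ.measurableSet, Lp.edist_def, eLpNorm_one_eq_lintegral_enorm]
  refine lintegral_mono_ae ?_
  filter_upwards [hu] with x hx
  rw [← hx]
  exact enorm_le_iff_norm_le.2 (ha _ _)

theorem IsTest.gradient_eq_zero {n : ℕ} {Ω : Set (Euc n)} {φ : Euc n → ℝ} (hφ : IsTest Ω φ)
    (x : Euc n) (hx : x ∉ Ω) : gradient φ x = 0 := by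
  ext j
  rw [gradient_apply_eq, image_eq_zero_of_notMem_tsupport fun h => hx ((hφ.isTest_partialD j).2.2 h)]
  rfl

theorem exists_test_of_mem_W2OneZero {n : ℕ} {Ω : Set (Euc n)} {v : W2 Ω 1} (hv : v ∈ W2OneZero Ω)
    {ε : ℝ≥0∞} (hε : 0 < ε) : ∃ u : W2 Ω 1, edist v u < ε ∧ ∃ φ : Euc n → ℝ, IsTest Ω φ ∧
      ∀ᵐ x ∂volume.restrict Ω, (jet u x).1 = φ x := by
  obtain ⟨u, hu, h⟩ := EMetric.mem_closure_iff.1 hv ε hε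
  exact ⟨u, h, hu⟩

theorem ae_eq_gradient_of_test {n : ℕ} {Ω : Set (Euc n)} (hΩ : IsOpen Ω) {u : W2 Ω 1}
    {φ : Euc n → ℝ} (hφ : IsTest Ω φ) (h : ∀ᵐ x ∂volume.restrict Ω, (jet u x).1 = φ x) :
    ∀ᵐ x ∂volume.restrict Ω, (jet u x).2.1 = gradient φ x :=
  hφ.ae_eq_gradient hΩ (integrable_jet u).snd.fst h fun ψ hψ j => (u.2 ψ hψ).1 j

theorem ae_eq_gradient_partialD_of_test {n : ℕ} {Ω : Set (Euc n)} (hΩ : IsOpen Ω) {u : W2 Ω 1}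
    {φ : Euc n → ℝ} (hφ : IsTest Ω φ) (h : ∀ᵐ x ∂volume.restrict Ω, (jet u x).1 = φ x)
    (i : Fin n) :
    ∀ᵐ x ∂volume.restrict Ω, hessRow i (jet u x) = gradient (partialD i φ) x := by
  refine (hφ.isTest_partialD i).ae_eq_gradient hΩ (f := fun x => (jet u x).2.1 i) ?_ ?_
    fun ψ hψ j => (u.2 ψ hψ).2 i j
  · refine (integrable_jet u).norm.mono' ((continuous_hessRow i).comp_aestronglyMeasurable
      (integrable_jet u).1) (Eventually.of_forall fun x => (norm_hessRow_le i _).trans ?_)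
    exact (norm_snd_le _).trans (norm_snd_le _)
  · filter_upwards [ae_eq_gradient_of_test hΩ hφ h] with x hx
    rw [hx, gradient_apply_eq]

/-- Functions in `W^{2,1}_0` extended by zero: differences are controlled along segments. -/
theorem ae_enorm_val_sub_le {n : ℕ} {Ω : Set (Euc n)} (hΩ : IsOpen Ω) {v : W2 Ω 1}
    (hv : v ∈ W2OneZero Ω) (h : Euc n) :
    ∀ᵐ x, ‖Ω.indicator (fun x => (jet v x).1) (x + h) - Ω.indicator (fun x => (jet v x).1) x‖ₑ ≤
      ‖h‖ₑ * ∫⁻ s in Set.Icc (0 : ℝ) 1, ‖Ω.indicator (fun x => (jet v x).2.1) (x + s • h)‖ₑ := by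
  refine ae_enorm_sub_le_of_approx
    ((stronglyMeasurable_jet v).fst.indicator hΩ.measurableSet)
    ((stronglyMeasurable_jet v).snd.fst.indicator hΩ.measurableSet) (fun ε hε => ?_) h
  obtain ⟨u, hu, φ, hφ, hu'⟩ := exists_test_of_mem_W2OneZero hv hε
  refine ⟨φ, hφ.1.of_le (by simp), ?_, ?_⟩
  · exact (lintegral_indicator_sub_le hΩ (a := Prod.fst) (fun z w => norm_fst_le (z - w))
      (fun x hx => image_eq_zero_of_notMem_tsupport fun h => hx (hφ.2.2 h)) hu').trans hu.le
  · exact (lintegral_indicator_sub_le hΩ (a := fun z : Jet n => z.2.1)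
      (fun z w => (norm_fst_le (z - w).2).trans (norm_snd_le (z - w))) hφ.gradient_eq_zero
      (ae_eq_gradient_of_test hΩ hφ hu')).trans hu.le

/-- Partial derivatives of test functions are again test functions, so the argument for the values
repeats with `hessRow i` as the gradient. -/
theorem ae_enorm_grad_sub_le {n : ℕ} {Ω : Set (Euc n)} (hΩ : IsOpen Ω) {v : W2 Ω 1}
    (hv : v ∈ W2OneZero Ω) (i : Fin n) (h : Euc n) :
    ∀ᵐ x, ‖Ω.indicator (fun x => (jet v x).2.1 i) (x + h) -
      Ω.indicator (fun x => (jet v x).2.1 i) x‖ₑ ≤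
      ‖h‖ₑ * ∫⁻ s in Set.Icc (0 : ℝ) 1, ‖Ω.indicator (fun x => hessRow i (jet v x)) (x + s • h)‖ₑ := by
  refine ae_enorm_sub_le_of_approx
    (((cGrad i).continuous.comp_stronglyMeasurable
      (stronglyMeasurable_jet v)).indicator hΩ.measurableSet)
    (((continuous_hessRow i).comp_stronglyMeasurable
      (stronglyMeasurable_jet v)).indicator hΩ.measurableSet) (fun ε hε => ?_) h
  obtain ⟨u, hu, φ, hφ, hu'⟩ := exists_test_of_mem_W2OneZero hv hε
  have hφi := hφ.isTest_partialD i
  refine ⟨partialD i φ, hφi.1.of_le (by simp), ?_, ?_⟩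
  · refine (lintegral_indicator_sub_le hΩ (a := fun z : Jet n => z.2.1 i)
      (fun z w => ?_)
      (fun x hx => image_eq_zero_of_notMem_tsupport fun h => hx (hφi.2.2 h))
      (u := u) ?_).trans hu.le
    · exact (PiLp.norm_apply_le (z - w).2.1 i).trans
        ((norm_fst_le (z - w).2).trans (norm_snd_le (z - w)))
    · filter_upwards [ae_eq_gradient_of_test hΩ hφ hu'] with x hx
      rw [hx, gradient_apply_eq]
  · refine (lintegral_indicator_sub_le hΩ (a := hessRow i)
      (fun z w => ?_) hφi.gradient_eq_zero
      (ae_eq_gradient_partialD_of_test hΩ hφ hu' i)).trans hu.le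
    rw [← hessRow_sub]
    exact (norm_hessRow_le i _).trans ((norm_snd_le (z - w).2).trans (norm_snd_le (z - w)))

/-- Since `h` moves every point of `Ω` out of `Ω`, the difference of the zero extension at `x ∈ Ω`
is just `-f x`. Jensen's inequality on `[0, 1]` then gives the constant `‖h‖` for every exponent
`p`. -/
theorem eLpNorm_le_of_segment {n : ℕ} {Ω : Set (Euc n)} (hΩ : MeasurableSet Ω) {f : Euc n → ℝ}
    {G : Euc n → Euc n} (hG : StronglyMeasurable G) {h : Euc n}
    (H : ∀ᵐ x, ‖Ω.indicator f (x + h) - Ω.indicator f x‖ₑ ≤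
      ‖h‖ₑ * ∫⁻ s in Set.Icc (0 : ℝ) 1, ‖Ω.indicator G (x + s • h)‖ₑ)
    (hh : ∀ x ∈ Ω, x + h ∉ Ω) {p : ℝ} (hp : 1 ≤ p) :
    eLpNorm f (ENNReal.ofReal p) (volume.restrict Ω) ≤
      ‖h‖ₑ * eLpNorm G (ENNReal.ofReal p) (volume.restrict Ω) := by
  have hp0 : 0 < p := by linarith
  have e : ∀ {F : Type} [NormedAddCommGroup F] (f : Euc n → F),
      eLpNorm f (ENNReal.ofReal p) (volume.restrict Ω) = (∫⁻ x in Ω, ‖f x‖ₑ ^ p) ^ (1 / p) := by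
    intro F _ f
    rw [eLpNorm_eq_lintegral_rpow_enorm_toReal (by simpa using hp0) (by simp),
      ENNReal.toReal_ofReal hp0.le]
  rw [e, e, one_div, ENNReal.rpow_inv_le_iff hp0, ENNReal.mul_rpow_of_nonneg _ _ hp0.le,
    ← ENNReal.rpow_mul, inv_mul_cancel₀ hp0.ne', ENNReal.rpow_one]
  have hGm : Measurable fun x => ‖Ω.indicator G x‖ₑ := (hG.indicator hΩ).enorm
  have jensen : ∀ x, (∫⁻ s in Set.Icc (0 : ℝ) 1, ‖Ω.indicator G (x + s • h)‖ₑ) ^ p ≤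
      ∫⁻ s in Set.Icc (0 : ℝ) 1, ‖Ω.indicator G (x + s • h)‖ₑ ^ p := by
    intro x
    have : IsProbabilityMeasure (volume.restrict (Set.Icc (0 : ℝ) 1)) := ⟨by simp⟩
    have hm : StronglyMeasurable fun s : ℝ => Ω.indicator G (x + s • h) :=
      (hG.indicator hΩ).comp_measurable (measurable_const.add (measurable_id.smul_const h))
    have h1 := eLpNorm'_le_eLpNorm'_of_exponent_le zero_lt_one hp
      (volume.restrict (Set.Icc (0 : ℝ) 1)) hm.aestronglyMeasurable
    simp only [eLpNorm', ENNReal.rpow_one, one_div, inv_one] at h1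
    exact (ENNReal.le_rpow_inv_iff hp0).1 h1
  calc ∫⁻ x in Ω, ‖f x‖ₑ ^ p
      ≤ ∫⁻ x in Ω, (‖h‖ₑ ^ p * ∫⁻ s in Set.Icc (0 : ℝ) 1, ‖Ω.indicator G (x + s • h)‖ₑ ^ p) := by
        refine lintegral_mono_ae ?_
        filter_upwards [ae_restrict_of_ae H, ae_restrict_mem hΩ] with x hx hxΩ
        rw [Set.indicator_of_notMem (hh x hxΩ), Set.indicator_of_mem hxΩ, zero_sub,
          enorm_neg] at hx
        calc ‖f x‖ₑ ^ p ≤ _ := ENNReal.rpow_le_rpow hx hp0.le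
          _ ≤ _ := by
            rw [ENNReal.mul_rpow_of_nonneg _ _ hp0.le]
            gcongr
            exact jensen x
    _ ≤ ∫⁻ x, (‖h‖ₑ ^ p * ∫⁻ s in Set.Icc (0 : ℝ) 1, ‖Ω.indicator G (x + s • h)‖ₑ ^ p) :=
        setLIntegral_le_lintegral _ _
    _ = ‖h‖ₑ ^ p * ∫⁻ x, ‖Ω.indicator G x‖ₑ ^ p := by
        rw [lintegral_const_mul _ (measurable_segment (hGm.pow_const p) h),
          lintegral_segment (hGm.pow_const p)]
    _ = ‖h‖ₑ ^ p * ∫⁻ x in Ω, ‖G x‖ₑ ^ p := by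
        rw [← lintegral_indicator hΩ]
        congr 1
        refine lintegral_congr fun x => ?_
        by_cases hx : x ∈ Ω <;> simp [hx, hp0]

theorem exists_translation {n : ℕ} (hn : 1 ≤ n) {Ω : Set (Euc n)} (hΩ : Bornology.IsBounded Ω) :
    ∃ h : Euc n, ∀ x ∈ Ω, x + h ∉ Ω := by
  obtain ⟨R, hR, hΩR⟩ := hΩ.exists_pos_norm_le
  refine ⟨EuclideanSpace.single ⟨0, hn⟩ (2 * R + 1), fun x hx hx' => ?_⟩
  have h1 := hΩR _ hx
  have h2 := hΩR _ hx'
  have h3 : ‖(EuclideanSpace.single ⟨0, hn⟩ (2 * R + 1) : Euc n)‖ = 2 * R + 1 := by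
    rw [PiLp.norm_single, Real.norm_eq_abs, abs_of_pos (by positivity)]
  have h4 := norm_sub_le (x + EuclideanSpace.single ⟨0, hn⟩ (2 * R + 1)) x
  rw [add_sub_cancel_left, h3] at h4
  linarith

/-- Poincaré's inequalities in `W^{2,1}_0`, for all exponents with the same constant. -/
theorem exists_poincare {n : ℕ} (hn : 1 ≤ n) {Ω : Set (Euc n)} (hΩ : IsOpen Ω)
    (hΩb : Bornology.IsBounded Ω) : ∃ D : ℝ≥0, ∀ v ∈ W2OneZero Ω, ∀ p : ℝ, 1 ≤ p →
      eLpNorm (fun x => (jet v x).1) (ENNReal.ofReal p) (volume.restrict Ω) ≤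
        D * eLpNorm (fun x => (jet v x).2.1) (ENNReal.ofReal p) (volume.restrict Ω) ∧
      ∀ i, eLpNorm (fun x => (jet v x).2.1 i) (ENNReal.ofReal p) (volume.restrict Ω) ≤
        D * eLpNorm (fun x => (jet v x).2.2) (ENNReal.ofReal p) (volume.restrict Ω) := by
  obtain ⟨h, hh⟩ := exists_translation hn hΩb
  refine ⟨‖h‖₊, fun v hv p hp => ⟨?_, fun i => ?_⟩⟩
  · exact eLpNorm_le_of_segment hΩ.measurableSet (stronglyMeasurable_jet v).snd.fst
      (ae_enorm_val_sub_le hΩ hv h) hh hp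
  · refine (eLpNorm_le_of_segment hΩ.measurableSet ((continuous_hessRow i).comp_stronglyMeasurable
      (stronglyMeasurable_jet v)) (ae_enorm_grad_sub_le hΩ hv i h) hh hp).trans ?_
    change ‖h‖ₑ * _ ≤ ‖h‖ₑ * _
    gcongr
    exact eLpNorm_mono fun x => norm_hessRow_le i _

/-! ### Rellich compactness by translation estimates. -/

theorem ENNReal.tendsto_zero_of_forall_le_mul {I : ℕ → ℝ≥0∞} (K : ℝ≥0)
    (h : ∀ ε : ℝ≥0, 0 < ε → ∀ᶠ j in atTop, I j ≤ ε * K) : Tendsto I atTop (𝓝 0) := by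
  rw [ENNReal.tendsto_nhds_zero]
  intro δ hδ
  obtain ⟨δ', h1, h2⟩ := ENNReal.lt_iff_exists_nnreal_btwn.1 hδ
  have h1' : 0 < δ' := by simpa using h1
  filter_upwards [h (δ' / (K + 1)) (by positivity)] with j hj
  refine hj.trans (le_trans ?_ h2.le)
  rw [← ENNReal.coe_mul, ENNReal.coe_le_coe, div_mul_eq_mul_div, div_le_iff₀ (by positivity)]
  gcongr
  simp

/-- A compactness criterion in `L^1`: uniform control of translations together with convergence
of the averages over balls. -/
theorem tendsto_lintegral_of_averages {n : ℕ} {Ω : Set (Euc n)} (hΩ : volume Ω ≠ ∞)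
    {F : ℕ → Euc n → ℝ} (hF : ∀ j, StronglyMeasurable (F j)) {B : ℝ≥0}
    (hB : ∀ j, ∫⁻ x, ‖F j x‖ₑ ≤ B)
    (hT : ∀ j h, ∫⁻ x, ‖F j (x + h) - F j x‖ₑ ≤ ‖h‖ₑ * B)
    (hA : ∀ x r, Tendsto (fun j => ∫ y in Metric.ball x r, F j y) atTop (𝓝 0)) :
    Tendsto (fun j => ∫⁻ x in Ω, ‖F j x‖ₑ) atTop (𝓝 0) := by
  refine ENNReal.tendsto_zero_of_forall_le_mul (B + 1) fun ε hε => ?_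
  set S : Set (Euc n) := Metric.ball 0 (ε : ℝ) with hS
  set V := volume S with hV
  have hV0 : V ≠ 0 := (Metric.measure_ball_pos volume _ (by exact_mod_cast hε)).ne'
  have hVt : V ≠ ∞ := measure_ball_lt_top.ne
  have hint : ∀ j, Integrable (F j) := fun j =>
    ⟨(hF j).aestronglyMeasurable, (hB j).trans_lt ENNReal.coe_lt_top⟩
  -- Unnormalised ball averages. They tend to zero pointwise and are bounded by `B`, so dominated
  -- convergence on `Ω` applies; `F j` differs from its average by a mean of translation
  -- differences, controlled by `hT`.
  let a : ℕ → Euc n → ℝ := fun j x => ∫ h in S, F j (x + h)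
  have ha : ∀ j x, a j x = ∫ y in Metric.ball x (ε : ℝ), F j y := by
    intro j x
    rw [← (measurePreserving_add_left volume x).setIntegral_preimage_emb
      (MeasurableEquiv.addLeft x).measurableEmbedding]
    simp [a, hS, preimage_add_ball]
  have ham : ∀ j, StronglyMeasurable (a j) := fun j =>
    StronglyMeasurable.integral_prod_right' (f := fun p : Euc n × Euc n => F j (p.1 + p.2))
      ((hF j).comp_measurable (measurable_fst.add measurable_snd))
  have haB : ∀ j x, ‖a j x‖ₑ ≤ B := by
    intro j x
    rw [ha]
    exact (enorm_integral_le_lintegral_enorm _).trans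
      ((setLIntegral_le_lintegral _ _).trans (hB j))
  have hlim : Tendsto (fun j => ∫⁻ x in Ω, ‖a j x‖ₑ) atTop (𝓝 0) := by
    have := tendsto_lintegral_of_dominated_convergence (μ := volume.restrict Ω)
      (F := fun j x => ‖a j x‖ₑ) (f := fun _ => 0) (fun _ => (B : ℝ≥0∞))
      (fun j => (ham j).enorm) (fun j => Eventually.of_forall (haB j))
      (by simpa using ENNReal.mul_ne_top ENNReal.coe_ne_top hΩ)
      (Eventually.of_forall fun x => by
        have := (continuous_enorm.tendsto _).comp (hA x ε)
        simp_rw [ha]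
        simpa [Function.comp_def] using this)
    simpa using this
  have key : ∀ j, (∫⁻ x in Ω, ‖F j x‖ₑ) * V ≤ ε * B * V + ∫⁻ x in Ω, ‖a j x‖ₑ := by
    intro j
    have hmeas : Measurable fun p : Euc n × Euc n => ‖F j (p.1 + p.2) - F j p.1‖ₑ :=
      (((hF j).comp_measurable (measurable_fst.add measurable_snd)).sub
        ((hF j).comp_measurable measurable_fst)).enorm
    have pt : ∀ x, ‖F j x‖ₑ * V ≤ (∫⁻ h in S, ‖F j (x + h) - F j x‖ₑ) + ‖a j x‖ₑ := by
      intro x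
      have i1 : IntegrableOn (fun h => F j (x + h)) S := ((hint j).comp_add_left x).integrableOn
      have i2 : IntegrableOn (fun _ => F j x) S := integrableOn_const hVt
      have e : V.toReal • F j x = a j x - ∫ h in S, (F j (x + h) - F j x) := by
        rw [integral_sub i1 i2]
        simp [a, Measure.real, hV]
      calc ‖F j x‖ₑ * V = ‖V.toReal • F j x‖ₑ := by
            rw [enorm_smul, Real.enorm_eq_ofReal ENNReal.toReal_nonneg, ENNReal.ofReal_toReal hVt,
              mul_comm]
        _ ≤ _ := by
            rw [e, add_comm]
            refine enorm_sub_le.trans ?_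
            gcongr
            exact enorm_integral_le_lintegral_enorm _
    calc (∫⁻ x in Ω, ‖F j x‖ₑ) * V = ∫⁻ x in Ω, ‖F j x‖ₑ * V := by
          rw [lintegral_mul_const _ (hF j).enorm]
      _ ≤ ∫⁻ x in Ω, ((∫⁻ h in S, ‖F j (x + h) - F j x‖ₑ) + ‖a j x‖ₑ) := lintegral_mono pt
      _ = (∫⁻ x in Ω, ∫⁻ h in S, ‖F j (x + h) - F j x‖ₑ) + ∫⁻ x in Ω, ‖a j x‖ₑ :=
          lintegral_add_right _ (ham j).enorm
      _ ≤ (∫⁻ x, ∫⁻ h in S, ‖F j (x + h) - F j x‖ₑ) + ∫⁻ x in Ω, ‖a j x‖ₑ := by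
          gcongr
          exact Measure.restrict_le_self
      _ = (∫⁻ h in S, ∫⁻ x, ‖F j (x + h) - F j x‖ₑ) + ∫⁻ x in Ω, ‖a j x‖ₑ := by
          rw [lintegral_lintegral_swap hmeas.aemeasurable]
      _ ≤ (∫⁻ h in S, ε * B) + ∫⁻ x in Ω, ‖a j x‖ₑ := by
          gcongr ?_ + _
          refine setLIntegral_mono measurable_const fun h hh => (hT j h).trans ?_
          gcongr
          rw [← ofReal_norm, ← ENNReal.ofReal_coe_nnreal]
          exact ENNReal.ofReal_le_ofReal (mem_ball_zero_iff.1 hh).le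
      _ = _ := by simp [hV]
  have hlim' := ENNReal.tendsto_nhds_zero.1 hlim (ε * V)
    (ENNReal.mul_pos (by exact_mod_cast hε.ne') hV0)
  filter_upwards [hlim'] with j hj
  refine (ENNReal.mul_le_mul_iff_left hV0 hVt).1 ((key j).trans ?_)
  calc _ ≤ ε * B * V + ε * V := by gcongr
    _ = _ := by push_cast; ring

/-- Set integrals of coordinates, as continuous linear functionals on `L^1`. -/
noncomputable def setIntegralCLM {α : Type*} [MeasurableSpace α] (μ : Measure α) {F : Type*}
    [NormedAddCommGroup F] [NormedSpace ℝ F] (c : F →L[ℝ] ℝ) (s : Set α) :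
    StrongDual ℝ (Lp F 1 μ) :=
  ContinuousLinearMap.comp
    { toFun := fun f : Lp ℝ 1 μ => ∫ x in s, f x ∂μ
      map_add' := fun f g => by
        rw [← integral_add (L1.integrable_coeFn f).integrableOn
          (L1.integrable_coeFn g).integrableOn]
        exact integral_congr_ae (ae_restrict_of_ae (Lp.coeFn_add f g))
      map_smul' := fun r f => by
        rw [RingHom.id_apply, ← integral_smul]
        exact integral_congr_ae (ae_restrict_of_ae (Lp.coeFn_smul r f))
      cont := continuous_setIntegral s }
    (c.compLpL 1 μ)

theorem setIntegralCLM_apply {α : Type*} [MeasurableSpace α] (μ : Measure α) {F : Type*}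
    [NormedAddCommGroup F] [NormedSpace ℝ F] (c : F →L[ℝ] ℝ) (s : Set α) (f : Lp F 1 μ) :
    setIntegralCLM μ c s f = ∫ x in s, c (f x) ∂μ :=
  integral_congr_ae (ae_restrict_of_ae (c.coeFn_compLpL f))

/-- Common to values and gradient components: `c` is the coordinate and `d` its gradient. Averages
over balls are continuous functionals on `L^1`, so weak convergence makes them converge. -/
theorem tendsto_lintegral_coord_of_convWeakly {n : ℕ} {Ω : Set (Euc n)} (hΩ : IsOpen Ω)
    (hΩb : Bornology.IsBounded Ω) {z : ℕ → W2 Ω 1} {B : ℝ≥0}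
    (hB : ∀ j, ∫⁻ x in Ω, ‖jet (z j) x‖ₑ ≤ B)
    (hz : ConvWeakly (fun j => (z j : Lp (Jet n) 1 (volume.restrict Ω))) 0) (c : Jet n →L[ℝ] ℝ)
    (hc : ∀ w, ‖c w‖ ≤ ‖w‖) (d : Jet n → Euc n) (hd : Continuous d) (hd' : ∀ w, ‖d w‖ ≤ ‖w‖)
    (H : ∀ j h, ∀ᵐ x, ‖Ω.indicator (fun x => c (jet (z j) x)) (x + h) -
      Ω.indicator (fun x => c (jet (z j) x)) x‖ₑ ≤
      ‖h‖ₑ * ∫⁻ s in Set.Icc (0 : ℝ) 1, ‖Ω.indicator (fun x => d (jet (z j) x)) (x + s • h)‖ₑ) :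
    Tendsto (fun j => ∫⁻ x in Ω, ‖c (jet (z j) x)‖ₑ) atTop (𝓝 0) := by
  have hm : ∀ j, StronglyMeasurable (Ω.indicator fun x => c (jet (z j) x)) := fun j =>
    (c.continuous.comp_stronglyMeasurable (stronglyMeasurable_jet _)).indicator hΩ.measurableSet
  have hdm : ∀ j, StronglyMeasurable (Ω.indicator fun x => d (jet (z j) x)) := fun j =>
    (hd.comp_stronglyMeasurable (stronglyMeasurable_jet _)).indicator hΩ.measurableSet
  have key := tendsto_lintegral_of_averages (Ω := Ω) hΩb.measure_lt_top.ne hm (B := B) ?_ ?_ ?_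
  · refine key.congr fun j => ?_
    refine setLIntegral_congr_fun hΩ.measurableSet fun x hx => ?_
    simp only [Set.indicator_of_mem hx]
  · intro j
    simp_rw [enorm_indicator_eq_indicator_enorm]
    rw [lintegral_indicator hΩ.measurableSet]
    exact (lintegral_mono fun x => enorm_le_iff_norm_le.2 (hc _)).trans (hB j)
  · intro j h
    refine (lintegral_mono_ae (H j h)).trans ?_
    rw [lintegral_const_mul _ (measurable_segment (hdm j).enorm h),
      lintegral_segment (hdm j).enorm]
    gcongr
    simp_rw [enorm_indicator_eq_indicator_enorm]
    rw [lintegral_indicator hΩ.measurableSet]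
    exact (lintegral_mono fun x => enorm_le_iff_norm_le.2 (hd' _)).trans (hB j)
  · intro x r
    have h1 := hz (setIntegralCLM _ c (Metric.ball x r))
    rw [map_zero] at h1
    refine h1.congr fun j => ?_
    rw [setIntegralCLM_apply, integral_indicator hΩ.measurableSet,
      Measure.restrict_restrict measurableSet_ball,
      Measure.restrict_restrict hΩ.measurableSet, Set.inter_comm]
    rfl

theorem enorm_le_sum_enorm_coord {n : ℕ} (p : Euc n) : ‖p‖ₑ ≤ ∑ i, ‖p i‖ₑ := by
  calc ‖p‖ₑ = ‖∑ i, EuclideanSpace.single i (p i)‖ₑ := by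
        congr 1; ext j; simp [Finset.sum_apply, Pi.single_apply]
    _ ≤ ∑ i, ‖(EuclideanSpace.single i (p i) : Euc n)‖ₑ := enorm_sum_le _ _
    _ = _ := by
        refine Finset.sum_congr rfl fun i _ => ?_
        rw [← ofReal_norm, PiLp.norm_single, ofReal_norm]

/-- Rellich compactness in `W^{2,1}_0`: lower order derivatives converge strongly. -/
theorem tendsto_lintegral_of_convWeakly {n : ℕ} {Ω : Set (Euc n)} (hΩ : IsOpen Ω)
    (hΩb : Bornology.IsBounded Ω) {z : ℕ → W2 Ω 1} (hz0 : ∀ j, z j ∈ W2OneZero Ω) {B : ℝ≥0}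
    (hB : ∀ j, ∫⁻ x in Ω, ‖jet (z j) x‖ₑ ≤ B)
    (hz : ConvWeakly (fun j => (z j : Lp (Jet n) 1 (volume.restrict Ω))) 0) :
    Tendsto (fun j => ∫⁻ x in Ω, (‖(jet (z j) x).1‖ₑ + ‖(jet (z j) x).2.1‖ₑ)) atTop (𝓝 0) := by
  have h1 := tendsto_lintegral_coord_of_convWeakly hΩ hΩb hB hz (cVal n)
    (fun w => norm_fst_le w) (fun w => w.2.1) (by fun_prop)
    (fun w => (norm_fst_le w.2).trans (norm_snd_le w))
    (fun j h => ae_enorm_val_sub_le hΩ (hz0 j) h)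
  have h2 := fun i => tendsto_lintegral_coord_of_convWeakly hΩ hΩb hB hz (cGrad i)
    (fun w => (PiLp.norm_apply_le w.2.1 i).trans ((norm_fst_le w.2).trans (norm_snd_le w)))
    (hessRow i) (continuous_hessRow i)
    (fun w => (norm_hessRow_le i w).trans ((norm_snd_le w.2).trans (norm_snd_le w)))
    (fun j h => ae_enorm_grad_sub_le hΩ (hz0 j) i h)
  have h3 := h1.add (tendsto_finsetSum Finset.univ fun i _ => h2 i)
  simp only [Finset.sum_const_zero, add_zero] at h3
  refine tendsto_of_tendsto_of_tendsto_of_le_of_le tendsto_const_nhds h3 (fun _ => zero_le)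
    fun j => ?_
  have hm : StronglyMeasurable (jet (z j)) := stronglyMeasurable_jet _
  simp only
  rw [← lintegral_finsetSum _ fun i _ =>
    ((cGrad i).continuous.comp_stronglyMeasurable hm).enorm,
    ← lintegral_add_left ((cVal n).continuous.comp_stronglyMeasurable hm).enorm]
  refine lintegral_mono fun x => ?_
  refine add_le_add le_rfl ?_
  exact enorm_le_sum_enorm_coord _

/-! ### Measurability of the supremand and closedness of the Sobolev classes. -/

/-- For a simple function in place of `w` the superposition is a finite sum of measurable pieces;
continuity in the jet variable passes to the limit of simple approximations. -/
theorem IsCaratheodory.aemeasurable_comp {n : ℕ} {Ω : Set (Euc n)}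
    {H : Euc n → ℝ → Euc n → SymMat n → ℝ} (hH : IsCaratheodory Ω H) {w : Euc n → Jet n}
    (hw : StronglyMeasurable w) :
    AEMeasurable (fun x => H x (w x).1 (w x).2.1 (w x).2.2) (volume.restrict Ω) := by
  have hs : ∀ s : SimpleFunc (Euc n) (Jet n),
      AEMeasurable (fun x => H x (s x).1 (s x).2.1 (s x).2.2) (volume.restrict Ω) := by
    intro s
    have e : (fun x => H x (s x).1 (s x).2.1 (s x).2.2) =
        fun x => ∑ z ∈ s.range, (s ⁻¹' {z}).indicator (fun x => H x z.1 z.2.1 z.2.2) x := by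
      funext x
      rw [Finset.sum_eq_single (s x)]
      · simp
      · intro z _ hz
        simp [hz.symm]
      · intro h
        exact absurd (s.mem_range_self x) h
    rw [e]
    exact Finset.aemeasurable_fun_sum _ fun z _ => (hH.1 _ _ _).indicator (s.measurableSet_fiber z)
  refine aemeasurable_of_tendsto_metrizable_ae atTop (fun k => hs (hw.approx k)) ?_
  filter_upwards [hH.2] with x hx
  exact (hx.tendsto (w x)).comp (hw.tendsto_approx x)

theorem IsCaratheodory.aemeasurable_supremand {n : ℕ} {Ω : Set (Euc n)}
    {H : Euc n → ℝ → Euc n → SymMat n → ℝ} (hH : IsCaratheodory Ω H) (u : W2 Ω ∞) :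
    AEMeasurable (supremand H u) (volume.restrict Ω) :=
  hH.aemeasurable_comp (stronglyMeasurable_jet u)

/-- Pairing with a fixed compactly supported function, as a functional on `L^1`. -/
noncomputable def pairingCLM {n : ℕ} (Ω : Set (Euc n)) (c : Jet n →L[ℝ] ℝ) (ψ : Euc n → ℝ)
    (hψ : Continuous ψ) (hc : HasCompactSupport ψ) :
    StrongDual ℝ (Lp (Jet n) 1 (volume.restrict Ω)) :=
  LinearMap.mkContinuousOfExistsBound
    { toFun := fun w => ∫ x in Ω, c (w x) * ψ x
      map_add' := fun w v => integral_coord_add le_rfl w v c hψ hc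
      map_smul' := fun a w => by
        rw [RingHom.id_apply, smul_eq_mul]
        exact integral_coord_smul (q := 1) a w c ψ }
    (by
      obtain ⟨C, hC⟩ := hc.exists_bound_of_continuous hψ
      refine ⟨‖c‖ * C, fun w => ?_⟩
      change ‖∫ x in Ω, c (w x) * ψ x‖ ≤ _
      rw [L1.norm_eq_integral_norm, ← integral_const_mul]
      refine norm_integral_le_of_norm_le ((L1.integrable_coeFn w).norm.const_mul _)
        (Eventually.of_forall fun x => ?_)
      rw [norm_mul]
      calc ‖c (w x)‖ * ‖ψ x‖ ≤ (‖c‖ * ‖w x‖) * C :=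
            mul_le_mul (c.le_opNorm _) (hC x) (norm_nonneg _) (by positivity)
        _ = _ := by ring)

/-- The weak derivative identities are equalities between continuous functionals on `L^1`.
Closedness lets `W^{2,1}_0` be treated as a closed convex subset of `L^1` itself, where weak limits
are taken. -/
theorem isClosed_W2_one {n : ℕ} (Ω : Set (Euc n)) :
    IsClosed (W2 Ω 1 : Set (Lp (Jet n) 1 (volume.restrict Ω))) := by
  have e : (W2 Ω 1 : Set (Lp (Jet n) 1 (volume.restrict Ω))) =
      ⋂ φ : {φ : Euc n → ℝ // IsTest Ω φ},
        (⋂ i, {w | pairingCLM Ω (cVal n) (partialD i φ.1) (φ.2.partialD_continuous i)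
            (φ.2.partialD_compact i) w =
              -pairingCLM Ω (cGrad i) φ.1 φ.2.1.continuous φ.2.2.1 w}) ∩
        ⋂ i, ⋂ j, {w | pairingCLM Ω (cGrad i) (partialD j φ.1) (φ.2.partialD_continuous j)
            (φ.2.partialD_compact j) w =
              -pairingCLM Ω (cHess i j) φ.1 φ.2.1.continuous φ.2.2.1 w} := by
    ext w
    simp only [Set.mem_iInter, Set.mem_inter_iff, Subtype.forall]
    exact Iff.rfl
  rw [e]
  refine isClosed_iInter fun φ => IsClosed.inter (isClosed_iInter fun i => ?_)
    (isClosed_iInter fun i => isClosed_iInter fun j => ?_) <;>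
  exact isClosed_eq (ContinuousLinearMap.continuous _) (ContinuousLinearMap.continuous _).neg

/-- `C_c^∞(Ω)` as a subspace of `W^{2,1}(Ω)`. -/
def testSubmodule {n : ℕ} (Ω : Set (Euc n)) : Submodule ℝ (W2 Ω 1) where
  carrier := {u | ∃ φ : Euc n → ℝ, IsTest Ω φ ∧ ∀ᵐ x ∂volume.restrict Ω, (jet u x).1 = φ x}
  add_mem' := by
    rintro u v ⟨φ, hφ, hu⟩ ⟨ψ, hψ, hv⟩
    refine ⟨φ + ψ, ⟨hφ.1.add hψ.1, hφ.2.1.add hψ.2.1,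
      (tsupport_add _ _).trans (Set.union_subset hφ.2.2 hψ.2.2)⟩, ?_⟩
    filter_upwards [hu, hv, Lp.coeFn_add (u : Lp (Jet n) 1 (volume.restrict Ω)) v]
      with x h1 h2 h3
    have h4 : jet (u + v) x = jet u x + jet v x := h3
    rw [h4, Prod.fst_add, h1, h2, Pi.add_apply]
  zero_mem' := by
    refine ⟨0, ⟨contDiff_const, HasCompactSupport.zero, by simp⟩, ?_⟩
    filter_upwards [Lp.coeFn_zero (Jet n) 1 (volume.restrict Ω)] with x h
    have h4 : jet (0 : W2 Ω 1) x = 0 := h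
    rw [h4]
    rfl
  smul_mem' := by
    rintro a u ⟨φ, hφ, hu⟩
    refine ⟨a • φ, ⟨hφ.1.const_smul a, hφ.2.1.smul_left (f := fun _ => a),
      (tsupport_smul_subset_right (fun _ => a) φ).trans hφ.2.2⟩, ?_⟩
    filter_upwards [hu, Lp.coeFn_smul a (u : Lp (Jet n) 1 (volume.restrict Ω))] with x h1 h3
    have h4 : jet (a • u) x = a • jet u x := h3
    rw [h4, Prod.smul_fst, h1, Pi.smul_apply]

theorem sub_mem_W2OneZero {n : ℕ} {Ω : Set (Euc n)} {u v : W2 Ω 1} (hu : u ∈ W2OneZero Ω)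
    (hv : v ∈ W2OneZero Ω) : u - v ∈ W2OneZero Ω :=
  (testSubmodule Ω).topologicalClosure.sub_mem hu hv

theorem isClosed_image_W2OneZero {n : ℕ} (Ω : Set (Euc n)) :
    IsClosed ((↑) '' W2OneZero Ω : Set (Lp (Jet n) 1 (volume.restrict Ω))) :=
  (isClosed_W2_one Ω).isClosedEmbedding_subtypeVal.isClosedMap _ isClosed_closure

theorem convex_image_W2OneZero {n : ℕ} (Ω : Set (Euc n)) :
    Convex ℝ ((↑) '' W2OneZero Ω : Set (Lp (Jet n) 1 (volume.restrict Ω))) :=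
  ((testSubmodule Ω).topologicalClosure.convex).linear_image (W2 Ω 1).subtype

theorem zero_mem_W2InfZero {n : ℕ} (Ω : Set (Euc n)) : (0 : W2 Ω ∞) ∈ W2InfZero Ω := by
  refine ⟨0, (testSubmodule Ω).topologicalClosure.zero_mem, ?_⟩
  exact (Lp.coeFn_zero (Jet n) 1 (volume.restrict Ω)).trans
    (Lp.coeFn_zero (Jet n) ∞ (volume.restrict Ω)).symm

theorem self_mem_W2InfAffine {n : ℕ} {Ω : Set (Euc n)} (g : W2 Ω ∞) : g ∈ W2InfAffine g := by
  change g - g ∈ W2InfZero Ω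
  rw [sub_self]
  exact zero_mem_W2InfZero Ω

theorem add_mem_W2InfAffine {n : ℕ} {Ω : Set (Euc n)} {g u φ : W2 Ω ∞} (hu : u ∈ W2InfAffine g)
    (hφ : φ ∈ W2InfZero Ω) : u + φ ∈ W2InfAffine g := by
  obtain ⟨v, hv, hv'⟩ := hu
  obtain ⟨w, hw, hw'⟩ := hφ
  refine ⟨v + w, (testSubmodule Ω).topologicalClosure.add_mem hv hw, ?_⟩
  have e : u + φ - g = (u - g) + φ := by abel
  rw [e]
  filter_upwards [hv', hw', Lp.coeFn_add (v : Lp (Jet n) 1 (volume.restrict Ω)) w,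
    Lp.coeFn_add ((u - g : W2 Ω ∞) : Lp (Jet n) ∞ (volume.restrict Ω)) φ] with x h1 h2 h3 h4
  have h5 : jet (v + w) x = jet v x + jet w x := h3
  have h6 : jet (u - g + φ) x = jet (u - g) x + jet φ x := h4
  rw [h5, h6, h1, h2]

/-! ### The functionals `E_p` and `E_∞` and approximate minimisers. -/

theorem neg_le_EPow {n : ℕ} {Ω : Set (Euc n)} (H : Euc n → ℝ → Euc n → SymMat n → ℝ) (M p : ℝ)
    (u : W2 Ω ∞) : ((-M : ℝ) : EReal) ≤ EPow H M p u := by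
  rw [EPow, EReal.le_sub_iff_add_le (by simp) (by simp), ← EReal.coe_add, neg_add_cancel]
  exact EReal.coe_ennreal_nonneg _

theorem EPow_le_iff {n : ℕ} {Ω : Set (Euc n)} {H : Euc n → ℝ → Euc n → SymMat n → ℝ} {M p c : ℝ}
    (hp : 0 < p) (hc : -M ≤ c) {u : W2 Ω ∞} : EPow H M p u ≤ (c : EReal) ↔
      ⨍⁻ x in Ω, ENNReal.ofReal (M + supremand H u x) ^ p ∂volume ≤ ENNReal.ofReal (M + c) ^ p := by
  rw [EPow, EReal.sub_le_iff_le_add (by simp) (by simp), ← EReal.coe_add, add_comm c M,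
    ← max_eq_left (show 0 ≤ M + c by linarith), ← EReal.coe_ennreal_ofReal,
    EReal.coe_ennreal_le_coe_ennreal_iff, one_div, ENNReal.rpow_inv_le_iff hp,
    max_eq_left (show 0 ≤ M + c by linarith)]

theorem EInf_le_iff {n : ℕ} {Ω : Set (Euc n)} {H : Euc n → ℝ → Euc n → SymMat n → ℝ} {c : ℝ}
    {u : W2 Ω ∞} : EInf H u ≤ (c : EReal) ↔ ∀ᵐ x ∂volume.restrict Ω, supremand H u x ≤ c := by
  constructor
  · intro h
    filter_upwards [ae_le_essSup (μ := volume.restrict Ω)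
      (f := fun x => (supremand H u x : EReal))] with x hx
    exact EReal.coe_le_coe_iff.1 (hx.trans h)
  · intro h
    refine essSup_le_of_ae_le _ ?_
    filter_upwards [h] with x hx
    exact EReal.coe_le_coe_iff.2 hx

theorem EPow_le_of_EInf_le {n : ℕ} {Ω : Set (Euc n)} {H : Euc n → ℝ → Euc n → SymMat n → ℝ}
    {M p c : ℝ} (hp : 0 < p) (hc : -M ≤ c) {u : W2 Ω ∞} (h : EInf H u ≤ (c : EReal)) :
    EPow H M p u ≤ (c : EReal) := by
  rw [EPow_le_iff hp hc]
  refine (lintegral_mono_ae (g := fun _ => ENNReal.ofReal (M + c) ^ p) ?_).trans ?_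
  · refine (Measure.smul_absolutelyContinuous.ae_le : _) ?_
    filter_upwards [EInf_le_iff.1 h] with x hx
    gcongr
  · rw [lintegral_const]
    refine (mul_le_mul_right ?_ _).trans_eq (mul_one _)
    simp only [Measure.smul_apply, smul_eq_mul]
    exact ENNReal.inv_mul_le_one _

theorem lintegral_le_of_EPow_le {n : ℕ} {Ω : Set (Euc n)} (hΩ : volume Ω ≠ 0)
    (hΩ' : volume Ω ≠ ∞) {H : Euc n → ℝ → Euc n → SymMat n → ℝ}
    {M p c : ℝ} (hp : 0 < p) (hc : -M ≤ c) {u : W2 Ω ∞} (h : EPow H M p u ≤ (c : EReal)) :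
    ∫⁻ x in Ω, ENNReal.ofReal (M + supremand H u x) ^ p ≤
      volume Ω * ENNReal.ofReal (M + c) ^ p := by
  rw [EPow_le_iff hp hc, setLAverage_eq, ENNReal.div_le_iff hΩ hΩ'] at h
  rwa [mul_comm]

/-- The infimum is a real number, at least `-M` and bounded above through `E_∞(v)`, so adding
`2^{-p}` strictly increases it. -/
theorem exists_isApproxMinimiser {n : ℕ} {Ω : Set (Euc n)} (H : Euc n → ℝ → Euc n → SymMat n → ℝ)
    {M p : ℝ} (hp : 0 < p) {g v : W2 Ω ∞} (hv : v ∈ W2InfAffine g) (hv' : EInf H v < ⊤) :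
    ∃ u, IsApproxMinimiser H M p g u := by
  obtain ⟨c, hc⟩ : ∃ c : ℝ, EInf H v ≤ c := by
    obtain ⟨c, h1, -⟩ := EReal.lt_iff_exists_real_btwn.1 hv'
    exact ⟨c, h1.le⟩
  have h1 : (⨅ v ∈ W2InfAffine g, EPow H M p v) ≤ ((max c (-M) : ℝ) : EReal) :=
    (iInf₂_le v hv).trans (EPow_le_of_EInf_le hp (le_max_right _ _)
      (hc.trans (EReal.coe_le_coe_iff.2 (le_max_left _ _))))
  have h2 : ((-M : ℝ) : EReal) ≤ ⨅ v ∈ W2InfAffine g, EPow H M p v :=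
    le_iInf₂ fun v _ => neg_le_EPow H M p v
  have h3 : (⨅ v ∈ W2InfAffine g, EPow H M p v) <
      (((2 : ℝ) ^ (-p) : ℝ) : EReal) + ⨅ v ∈ W2InfAffine g, EPow H M p v := by
    generalize (⨅ v ∈ W2InfAffine g, EPow H M p v) = I at *
    induction I with
    | bot => simp at h2
    | top => exact absurd (top_le_iff.1 h1) (EReal.coe_ne_top _)
    | coe I =>
      rw [← EReal.coe_add, EReal.coe_lt_coe_iff]
      linarith [Real.rpow_pos_of_pos (zero_lt_two (α := ℝ)) (-p)]
  obtain ⟨u, hu⟩ := iInf_lt_iff.1 h3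
  obtain ⟨hu1, hu2⟩ := iInf_lt_iff.1 hu
  exact ⟨u, hu1, hu2.le⟩

theorem IsApproxMinimiser.EPow_le {n : ℕ} {Ω : Set (Euc n)} {H : Euc n → ℝ → Euc n → SymMat n → ℝ}
    {M p c : ℝ} (hp : 0 < p) (hc : -M ≤ c) {g u v : W2 Ω ∞} (hu : IsApproxMinimiser H M p g u)
    (hv : v ∈ W2InfAffine g) (h : EInf H v ≤ (c : EReal)) :
    EPow H M p u ≤ ((c + 2 ^ (-p) : ℝ) : EReal) := by
  rw [add_comm, EReal.coe_add]
  exact hu.2.trans (add_le_add le_rfl ((iInf₂_le v hv).trans (EPow_le_of_EInf_le hp hc h)))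

/-! ### Bounds on jets uniform in `p`. -/

theorem exists_rpow_le_linear {s δ : ℝ} (hs : 0 ≤ s) (hs' : s < 1) (hδ : 0 < δ) :
    ∃ T, ∀ a : ℝ, 0 ≤ a → a ^ s ≤ δ * a + T := by
  have h := tendsto_rpow_neg_atTop (sub_pos.2 hs')
  obtain ⟨T, hT⟩ := eventually_atTop.1 ((h.eventually (gt_mem_nhds hδ)).and (eventually_ge_atTop 1))
  refine ⟨(max T 1) ^ s, fun a ha => ?_⟩
  have hT1 : 0 < max T 1 := lt_max_of_lt_right one_pos
  rcases le_total a (max T 1) with h1 | h1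
  · have := Real.rpow_le_rpow ha h1 hs
    nlinarith [mul_nonneg hδ.le ha]
  · have ha' : 0 < a := hT1.trans_le h1
    have h2 := (hT a ((le_max_left _ _).trans h1)).1
    have h3 : a ^ s = a ^ (-(1 - s)) * a := by
      rw [← Real.rpow_add_one ha'.ne']
      congr 1; ring
    rw [h3]
    have := Real.rpow_nonneg hT1.le s
    nlinarith

/-- The constant `C` is fixed before `κ`, and only `K` depends on `κ`. Thus `κ` can later be taken
small compared with the Poincaré constant. -/
theorem coercive_linear {n : ℕ} {Ω : Set (Euc n)} {H : Euc n → ℝ → Euc n → SymMat n → ℝ}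
    (hH : ∃ C₁ > (0 : ℝ), ∃ C₂ > (0 : ℝ), ∃ s t : ℝ, 0 ≤ s ∧ s < 1 ∧ 0 ≤ t ∧ t < 1 ∧
      ∀ᵐ x ∂volume.restrict Ω, ∀ (η : ℝ) (p : Euc n) (X : SymMat n),
        C₁ * ‖X‖ - C₂ * (1 + |η| ^ s + ‖p‖ ^ t) ≤ H x η p X) {M : ℝ} :
    ∃ C : ℝ, 0 ≤ C ∧ ∀ κ > (0 : ℝ), ∃ K : ℝ, ∀ᵐ x ∂volume.restrict Ω,
      ∀ (η : ℝ) (p : Euc n) (X : SymMat n),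
        ‖X‖ ≤ C * (M + H x η p X) + K + κ * (|η| + ‖p‖) := by
  obtain ⟨C₁, h1, C₂, h2, s, t, hs, hs', ht, ht', h⟩ := hH
  refine ⟨C₁⁻¹, by positivity, fun κ hκ => ?_⟩
  have hδ : 0 < κ * C₁ / C₂ := by positivity
  obtain ⟨S, hS⟩ := exists_rpow_le_linear hs hs' hδ
  obtain ⟨T, hT⟩ := exists_rpow_le_linear ht ht' hδ
  refine ⟨C₁⁻¹ * (C₂ * (1 + S + T) - M), ?_⟩
  filter_upwards [h] with x hx η p X
  have a1 := hx η p X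
  have a2 := mul_le_mul_of_nonneg_left (hS _ (abs_nonneg η)) h2.le
  have a3 := mul_le_mul_of_nonneg_left (hT _ (norm_nonneg p)) h2.le
  have a4 : ∀ a : ℝ, C₂ * (κ * C₁ / C₂ * a) = C₁ * (κ * a) := fun a => by field_simp
  rw [mul_add, a4] at a2 a3
  have a5 : C₁ * ‖X‖ ≤ M + H x η p X + (C₂ * (1 + S + T) - M) + C₁ * (κ * (|η| + ‖p‖)) := by
    linarith
  have a6 := mul_le_mul_of_nonneg_left a5 (inv_nonneg.2 h1.le)
  rw [inv_mul_cancel_left₀ h1.ne', mul_add, inv_mul_cancel_left₀ h1.ne', mul_add] at a6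
  exact a6

theorem ENNReal.rpow_le_one_add {a : ℝ≥0∞} {r : ℝ} (h0 : 0 ≤ r) (h1 : r ≤ 1) :
    a ^ r ≤ 1 + a := by
  rcases le_total a 1 with h | h
  · exact (ENNReal.rpow_le_one h h0).trans le_self_add
  · refine (ENNReal.rpow_le_rpow_of_exponent_le h h1).trans ?_
    rw [ENNReal.rpow_one]
    exact le_add_self

theorem eLpNorm_const_le {α : Type*} [MeasurableSpace α] (μ : Measure α) (c : ℝ) {p : ℝ}
    (hp : 1 ≤ p) : eLpNorm (fun _ : α => c) (ENNReal.ofReal p) μ ≤ ‖c‖ₑ * (1 + μ Set.univ) := by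
  have hp0 : 0 < p := by linarith
  rw [eLpNorm_const' c (by simpa using hp0) (by simp), ENNReal.toReal_ofReal hp0.le]
  gcongr
  exact ENNReal.rpow_le_one_add (by positivity) ((div_le_one hp0).2 hp)

theorem eLpNorm_sum_coord_le {n : ℕ} {Ω : Set (Euc n)} {f : Euc n → Euc n}
    (hf : StronglyMeasurable f) {p : ℝ≥0∞} (hp : 1 ≤ p) {A : ℝ≥0∞}
    (h : ∀ i, eLpNorm (fun x => f x i) p (volume.restrict Ω) ≤ A) :
    eLpNorm f p (volume.restrict Ω) ≤ n * A := by
  have hm : ∀ i ∈ Finset.univ, AEStronglyMeasurable (fun x => ‖f x i‖) (volume.restrict Ω) :=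
    fun i _ => ((EuclideanSpace.proj i : Euc n →L[ℝ] ℝ).continuous.comp_stronglyMeasurable
      hf).norm.aestronglyMeasurable
  calc eLpNorm f p (volume.restrict Ω)
      ≤ eLpNorm (∑ i, fun x => ‖f x i‖) p (volume.restrict Ω) := by
        refine eLpNorm_mono_real fun x => ?_
        rw [Finset.sum_apply]
        have := enorm_le_sum_enorm_coord (f x)
        rw [← ofReal_norm] at this
        simp_rw [← ofReal_norm] at this
        rw [← ENNReal.ofReal_sum_of_nonneg fun i _ => norm_nonneg _] at this
        exact (ENNReal.ofReal_le_ofReal_iff (Finset.sum_nonneg fun i _ => norm_nonneg _)).1 this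
    _ ≤ ∑ i, eLpNorm (fun x => ‖f x i‖) p (volume.restrict Ω) := eLpNorm_sum_le hm hp
    _ ≤ ∑ _i : Fin n, A := by
        refine Finset.sum_le_sum fun i _ => ?_
        rw [eLpNorm_norm]
        exact h i
    _ = n * A := by simp

theorem ENNReal.le_two_mul_of_le_add_half {a b : ℝ≥0∞} (ha : a ≠ ∞) (h : a ≤ b + a / 2) :
    a ≤ 2 * b := by
  have h1 : a / 2 + a / 2 ≤ b + a / 2 := by rwa [ENNReal.add_halves]
  have h2 := (ENNReal.add_le_add_iff_right (ENNReal.div_ne_top ha (by simp))).1 h1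
  calc a = 2 * (a / 2) := by rw [two_mul, ENNReal.add_halves]
    _ ≤ _ := by gcongr

/-- On `Ω` the quantity `M + H` is positive, so its absolute value equals its truncation; the factor
`|Ω|^{1/p}` is at most `1 + |Ω|` for every `p ≥ 1`. -/
theorem eLpNorm_supremand_le {n : ℕ} {Ω : Set (Euc n)}
    {H : Euc n → ℝ → Euc n → SymMat n → ℝ} {m M K p : ℝ}
    (hH_below : ∀ x ∈ Ω, ∀ η p X, -m ≤ H x η p X) (hM : m < M) (hΩ : MeasurableSet Ω)
    (hp : 1 ≤ p) {u : W2 Ω ∞}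
    (h : ∫⁻ x in Ω, ENNReal.ofReal (M + supremand H u x) ^ p ≤
      volume Ω * ENNReal.ofReal K ^ p) :
    eLpNorm (fun x => M + supremand H u x) (ENNReal.ofReal p) (volume.restrict Ω) ≤
      (1 + volume Ω) * ENNReal.ofReal K := by
  have hp0 : 0 < p := by linarith
  rw [eLpNorm_eq_lintegral_rpow_enorm_toReal (by simpa using hp0) (by simp),
    ENNReal.toReal_ofReal hp0.le, one_div, ENNReal.rpow_inv_le_iff hp0]
  have e : ∫⁻ x in Ω, ‖M + supremand H u x‖ₑ ^ p =
      ∫⁻ x in Ω, ENNReal.ofReal (M + supremand H u x) ^ p := by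
    refine setLIntegral_congr_fun hΩ fun x hx => ?_
    have := hH_below x hx (jet u x).1 (jet u x).2.1 (jet u x).2.2
    rw [Real.enorm_eq_ofReal]
    change 0 ≤ M + H x (jet u x).1 (jet u x).2.1 (jet u x).2.2
    linarith
  rw [e, ENNReal.mul_rpow_of_nonneg _ _ hp0.le]
  refine h.trans ?_
  gcongr
  rw [← ENNReal.rpow_inv_le_iff hp0]
  exact ENNReal.rpow_le_one_add (by positivity) (inv_le_one_of_one_le₀ hp)

set_option maxHeartbeats 2000000 in
/-- Uniform `L^p` bounds on jets, for all `p`, from coercivity and Poincaré's inequality. -/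
theorem exists_uniform_bound {n : ℕ} (hn : 1 ≤ n) {Ω : Set (Euc n)} (hΩ : IsOpen Ω)
    (hΩb : Bornology.IsBounded Ω) {H : Euc n → ℝ → Euc n → SymMat n → ℝ}
    (hH_car : IsCaratheodory Ω H) {m M : ℝ}
    (hH_below : ∀ x ∈ Ω, ∀ η p X, -m ≤ H x η p X) (hM : m < M)
    (hH : ∃ C₁ > (0 : ℝ), ∃ C₂ > (0 : ℝ), ∃ s t : ℝ, 0 ≤ s ∧ s < 1 ∧ 0 ≤ t ∧ t < 1 ∧
      ∀ᵐ x ∂volume.restrict Ω, ∀ (η : ℝ) (p : Euc n) (X : SymMat n),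
        C₁ * ‖X‖ - C₂ * (1 + |η| ^ s + ‖p‖ ^ t) ≤ H x η p X) (g : W2 Ω ∞) (K : ℝ) :
    ∃ B : ℝ≥0, ∀ p : ℝ, 1 ≤ p → ∀ u ∈ W2InfAffine g,
      ∫⁻ x in Ω, ENNReal.ofReal (M + supremand H u x) ^ p ≤ volume Ω * ENNReal.ofReal K ^ p →
      eLpNorm (jet (u - g)) (ENNReal.ofReal p) (volume.restrict Ω) ≤ B := by
  obtain ⟨D, hD⟩ := exists_poincare hn hΩ hΩb
  obtain ⟨C, hC0, hC⟩ := coercive_linear (M := M) hH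
  -- `L` bounds the norms of value and gradient together by that of the Hessian, the factor `n`
  -- coming from summing gradient components. The choice of `κ` gives `κ L ≤ 1/2`, which allows
  -- absorption.
  set L : ℝ≥0 := D * (n * D) + n * D with hL
  set κ : ℝ := 1 / (2 * (L + 1)) with hκ
  have hκ0 : 0 < κ := by positivity
  obtain ⟨K₀, hK₀⟩ := hC κ hκ0
  have hV : volume Ω ≠ ∞ := hΩb.measure_lt_top.ne
  set G : ℝ := (eLpNorm (jet g) ∞ (volume.restrict Ω)).toReal with hG
  have hgb : ∀ᵐ x ∂volume.restrict Ω, ‖jet g x‖ ≤ G := by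
    have h1 : eLpNorm (jet g) ∞ (volume.restrict Ω) ≠ ∞ := (Lp.memLp g.1).2.ne
    filter_upwards [ae_le_eLpNormEssSup (f := jet g) (μ := volume.restrict Ω)] with x hx
    rw [← eLpNorm_exponent_top] at hx
    have := ENNReal.toReal_mono h1 hx
    rwa [toReal_enorm] at this
  set K₁ : ℝ := K₀ + G + κ * (G + G) with hK₁
  set A : ℝ≥0∞ := ‖C‖ₑ * ((1 + volume Ω) * ENNReal.ofReal K) + ‖K₁‖ₑ * (1 + volume Ω) with hA
  have hA' : A ≠ ∞ := by
    simp [hA, ENNReal.mul_eq_top, hV]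
  refine ⟨((L + 1) * (2 * A)).toNNReal, fun p hp u hu hE => ?_⟩
  rw [ENNReal.coe_toNNReal (ENNReal.mul_ne_top (by simp) (ENNReal.mul_ne_top (by simp) hA'))]
  have hp1 : 1 ≤ ENNReal.ofReal p := by simpa using hp
  obtain ⟨v, hv, hvu⟩ := hu
  have hjm : StronglyMeasurable (jet (u - g)) := stronglyMeasurable_jet _
  obtain ⟨P1, P2⟩ := hD v hv p hp
  have c1 : eLpNorm (fun x => (jet v x).1) (ENNReal.ofReal p) (volume.restrict Ω) =
      eLpNorm (fun x => (jet (u - g) x).1) (ENNReal.ofReal p) (volume.restrict Ω) :=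
    eLpNorm_congr_ae (hvu.fun_comp Prod.fst)
  have c2 : eLpNorm (fun x => (jet v x).2.1) (ENNReal.ofReal p) (volume.restrict Ω) =
      eLpNorm (fun x => (jet (u - g) x).2.1) (ENNReal.ofReal p) (volume.restrict Ω) :=
    eLpNorm_congr_ae (hvu.fun_comp fun z => z.2.1)
  have c3 : eLpNorm (fun x => (jet v x).2.2) (ENNReal.ofReal p) (volume.restrict Ω) =
      eLpNorm (fun x => (jet (u - g) x).2.2) (ENNReal.ofReal p) (volume.restrict Ω) :=
    eLpNorm_congr_ae (hvu.fun_comp fun z => z.2.2)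
  have c4 : ∀ i, eLpNorm (fun x => (jet v x).2.1 i) (ENNReal.ofReal p) (volume.restrict Ω) =
      eLpNorm (fun x => (jet (u - g) x).2.1 i) (ENNReal.ofReal p) (volume.restrict Ω) :=
    fun i => eLpNorm_congr_ae (hvu.fun_comp fun z => z.2.1 i)
  rw [c1, c2] at P1
  simp_rw [c4, c3] at P2
  set a := eLpNorm (fun x => (jet (u - g) x).2.2) (ENNReal.ofReal p) (volume.restrict Ω) with ha
  -- Finiteness, needed to subtract `a / 2`, comes from `u - g ∈ W^{2,∞}` on a set of finite
  -- measure.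
  have ha' : a ≠ ∞ := by
    have : IsFiniteMeasure (volume.restrict Ω) := ⟨by simpa using hV.lt_top⟩
    have h1 : MemLp (jet (u - g)) (ENNReal.ofReal p) (volume.restrict Ω) :=
      (Lp.memLp (u - g).1).mono_exponent le_top
    exact (h1.snd.snd).2.ne
  have Q2 := eLpNorm_sum_coord_le hjm.snd.fst hp1 P2
  have Q1 : eLpNorm (fun x => (jet (u - g) x).1) (ENNReal.ofReal p) (volume.restrict Ω) ≤
      D * (n * (D * a)) := P1.trans (by gcongr)
  have hjet : ∀ᵐ x ∂volume.restrict Ω, jet (u - g) x = jet u x - jet g x :=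
    Lp.coeFn_sub u.1 g.1
  have m0 : AEStronglyMeasurable (fun x => M + supremand H u x) (volume.restrict Ω) :=
    ((hH_car.aemeasurable_supremand u).const_add M).aestronglyMeasurable
  have m1 : AEStronglyMeasurable (fun x => ‖(jet (u - g) x).1‖) (volume.restrict Ω) :=
    hjm.fst.norm.aestronglyMeasurable
  have m2 : AEStronglyMeasurable (fun x => ‖(jet (u - g) x).2.1‖) (volume.restrict Ω) :=
    hjm.snd.fst.norm.aestronglyMeasurable
  have m3 : AEStronglyMeasurable (fun x => ‖(jet (u - g) x).2.2‖) (volume.restrict Ω) :=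
    hjm.snd.snd.norm.aestronglyMeasurable
  have bound : a ≤ A + a / 2 := by
    calc a ≤ eLpNorm ((C • fun x => M + supremand H u x) + (fun _ => K₁) +
          (κ • ((fun x => ‖(jet (u - g) x).1‖) + fun x => ‖(jet (u - g) x).2.1‖)))
          (ENNReal.ofReal p) (volume.restrict Ω) := by
          refine eLpNorm_mono_ae_real ?_
          filter_upwards [hK₀, hgb, hjet] with x h1 h2 h3
          have h4 := h1 (jet u x).1 (jet u x).2.1 (jet u x).2.2
          have h5 : ‖(jet (u - g) x).2.2‖ ≤ ‖(jet u x).2.2‖ + G := by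
            rw [h3]
            exact (norm_sub_le _ _).trans (by
              gcongr; exact ((norm_snd_le _).trans (norm_snd_le _)).trans h2)
          have h6 : |(jet u x).1| ≤ ‖(jet (u - g) x).1‖ + G := by
            have e : (jet u x).1 = (jet (u - g) x).1 + (jet g x).1 := by rw [h3]; simp
            rw [e]
            exact (abs_add_le _ _).trans (add_le_add le_rfl ((norm_fst_le _).trans h2))
          have h7 : ‖(jet u x).2.1‖ ≤ ‖(jet (u - g) x).2.1‖ + G := by
            have e : (jet u x).2.1 = (jet (u - g) x).2.1 + (jet g x).2.1 := by rw [h3]; simp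
            rw [e]
            exact (norm_add_le _ _).trans
              (add_le_add le_rfl (((norm_fst_le _).trans (norm_snd_le _)).trans h2))
          have h8 := mul_le_mul_of_nonneg_left (add_le_add h6 h7) hκ0.le
          simp only [Pi.add_apply, Pi.smul_apply, smul_eq_mul]
          change _ ≤ C * (M + H x (jet u x).1 (jet u x).2.1 (jet u x).2.2) + _ + _
          rw [hK₁]
          linarith
      _ ≤ eLpNorm (C • fun x => M + supremand H u x) (ENNReal.ofReal p) (volume.restrict Ω) +
          eLpNorm (fun _ => K₁) (ENNReal.ofReal p) (volume.restrict Ω) +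
          eLpNorm (κ • ((fun x => ‖(jet (u - g) x).1‖) + fun x => ‖(jet (u - g) x).2.1‖))
          (ENNReal.ofReal p) (volume.restrict Ω) := by
          refine (eLpNorm_add_le ((m0.const_smul C).add aestronglyMeasurable_const)
            ((m1.add m2).const_smul κ) hp1).trans ?_
          gcongr
          exact eLpNorm_add_le (m0.const_smul C) aestronglyMeasurable_const hp1
      _ ≤ A + ‖κ‖ₑ * (D * (n * (D * a)) + n * (D * a)) := by
          rw [hA]
          gcongr
          · rw [eLpNorm_const_smul]
            gcongr
            exact eLpNorm_supremand_le hH_below hM hΩ.measurableSet hp hE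
          · simpa using eLpNorm_const_le (volume.restrict Ω) K₁ hp
          · rw [eLpNorm_const_smul]
            gcongr
            refine (eLpNorm_add_le m1 m2 hp1).trans ?_
            rw [eLpNorm_norm, eLpNorm_norm]
            exact add_le_add Q1 Q2
      _ ≤ A + a / 2 := by
          gcongr
          have e : (D : ℝ≥0∞) * (n * (D * a)) + n * (D * a) = L * a := by
            rw [hL]; push_cast; ring
          rw [e, ← mul_assoc, ENNReal.div_eq_inv_mul]
          gcongr
          rw [Real.enorm_eq_ofReal hκ0.le, ← ENNReal.ofReal_coe_nnreal,
            ← ENNReal.ofReal_mul hκ0.le]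
          have : ENNReal.ofReal (1 / 2 : ℝ) = 2⁻¹ := by
            rw [one_div, ENNReal.ofReal_inv_of_pos two_pos]; simp
          rw [← this]
          refine ENNReal.ofReal_le_ofReal ?_
          rw [hκ, div_mul_eq_mul_div, one_mul, div_le_div_iff₀ (by positivity) two_pos]
          linarith
  have ha2 := ENNReal.le_two_mul_of_le_add_half ha' bound
  calc eLpNorm (jet (u - g)) (ENNReal.ofReal p) (volume.restrict Ω)
      ≤ eLpNorm ((fun x => ‖(jet (u - g) x).1‖) + (fun x => ‖(jet (u - g) x).2.1‖) +
          fun x => ‖(jet (u - g) x).2.2‖) (ENNReal.ofReal p) (volume.restrict Ω) := by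
        refine eLpNorm_mono_real fun x => ?_
        simp only [Pi.add_apply]
        rw [Prod.norm_def, Prod.norm_def]
        have q1 := norm_nonneg (jet (u - g) x).1
        have q2 := norm_nonneg (jet (u - g) x).2.1
        have q3 := norm_nonneg (jet (u - g) x).2.2
        refine max_le (by linarith) (max_le (by linarith) (by linarith))
    _ ≤ D * (n * (D * a)) + n * (D * a) + a := by
        refine (eLpNorm_add_le (m1.add m2) m3 hp1).trans ?_
        rw [eLpNorm_norm]
        gcongr
        refine (eLpNorm_add_le m1 m2 hp1).trans ?_
        rw [eLpNorm_norm, eLpNorm_norm]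
        exact add_le_add Q1 Q2
    _ = (L + 1) * a := by rw [hL]; push_cast; ring
    _ ≤ _ := by gcongr

/-! ### Eventual pointwise bounds and freezing of lower-order arguments. -/

/-- Bounds on `L^p` norms with `p → ∞` give eventual pointwise bounds, by Borel–Cantelli. -/
theorem ae_eventually_lt_of_lintegral_rpow_le {α : Type*} [MeasurableSpace α] {μ : Measure α}
    {f : ℕ → α → ℝ≥0∞} (hf : ∀ j, AEMeasurable (f j) μ) {V : ℝ≥0∞} (hV : V ≠ ∞) {a b : ℝ}
    (ha : 0 < a) (hab : a < b)
    (h : ∀ᶠ j in atTop, ∫⁻ x, f j x ^ ((j : ℝ) + 2) ∂μ ≤ V * ENNReal.ofReal a ^ ((j : ℝ) + 2)) :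
    ∀ᵐ x ∂μ, ∀ᶠ j in atTop, f j x < ENNReal.ofReal b := by
  obtain ⟨N, hN⟩ := eventually_atTop.1 h
  have hb : 0 < b := ha.trans hab
  set θ : ℝ := a / b with hθ
  have hθ0 : 0 ≤ θ := by positivity
  have hθ1 : θ < 1 := (div_lt_one hb).2 hab
  -- Chebyshev at exponent `j + 2` gives the ratio `θ^(j+2) ≤ θ^j`, which is summable. Including `N
  -- ≤ j` in the set makes the bound trivial for the early indices.
  have hs : ∀ j, μ {x | N ≤ j ∧ ENNReal.ofReal b ≤ f j x} ≤ V * ENNReal.ofReal (θ ^ j) := by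
    intro j
    by_cases hj : N ≤ j
    · have hp : 0 < (j : ℝ) + 2 := by positivity
      have e : {x | N ≤ j ∧ ENNReal.ofReal b ≤ f j x} =
          {x | ENNReal.ofReal b ^ ((j : ℝ) + 2) ≤ f j x ^ ((j : ℝ) + 2)} := by
        ext x
        simp [hj, ENNReal.rpow_le_rpow_iff hp]
      have hb0 : ENNReal.ofReal b ^ ((j : ℝ) + 2) ≠ 0 := by
        rw [ENNReal.ofReal_rpow_of_pos hb]
        simpa using Real.rpow_pos_of_pos hb _
      rw [e]
      refine (meas_ge_le_lintegral_div ((hf j).pow_const _) hb0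
        (ENNReal.rpow_ne_top_of_nonneg hp.le (by simp))).trans ?_
      refine (ENNReal.div_le_div_right (hN j hj) _).trans ?_
      rw [mul_div_assoc, ← ENNReal.div_rpow_of_nonneg _ _ hp.le, ← ENNReal.ofReal_div_of_pos hb,
        ENNReal.ofReal_rpow_of_nonneg hθ0 hp.le]
      gcongr
      rw [← Real.rpow_natCast]
      exact Real.rpow_le_rpow_of_exponent_ge (by positivity) hθ1.le (by linarith)
    · have e : {x | N ≤ j ∧ ENNReal.ofReal b ≤ f j x} = ∅ := by
        ext x; simp [hj]
      rw [e]; simp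
  have hsum : ∑' j, μ {x | N ≤ j ∧ ENNReal.ofReal b ≤ f j x} ≠ ∞ := by
    refine ne_top_of_le_ne_top ?_ (ENNReal.tsum_le_tsum hs)
    rw [ENNReal.tsum_mul_left]
    refine ENNReal.mul_ne_top hV ?_
    rw [← ENNReal.ofReal_tsum_of_nonneg (fun j => by positivity)
      (summable_geometric_of_lt_one hθ0 hθ1)]
    exact ENNReal.ofReal_ne_top
  filter_upwards [ae_eventually_notMem hsum] with x hx
  filter_upwards [hx, eventually_ge_atTop N] with j hj hj'
  simpa [hj'] using hj

/-- Continuity allows freezing the lower order arguments along bounded sequences of jets. -/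
theorem eventually_le_freeze {n : ℕ} {f : Jet n → ℝ} (hf : Continuous f) {a : ℕ → Jet n} {R : ℝ}
    (ha : ∀ᶠ i in atTop, ‖a i‖ ≤ R) {η : ℝ} {p : Euc n}
    (h1 : Tendsto (fun i => (a i).1) atTop (𝓝 η)) (h2 : Tendsto (fun i => (a i).2.1) atTop (𝓝 p))
    {τ ε : ℝ} (hε : 0 < ε) (h : ∀ᶠ i in atTop, f (a i) ≤ τ) :
    ∀ᶠ i in atTop, f (η, p, (a i).2.2) ≤ τ + ε := by
  -- The radius also covers `η` and `p`, so both the original and the frozen jets stay in one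
  -- compact ball, where `f` is uniformly continuous.
  set R' := max R (max |η| ‖p‖) with hR'
  have huc : UniformContinuousOn f (Metric.closedBall 0 R') :=
    (isCompact_closedBall 0 R').uniformContinuousOn_of_continuous hf.continuousOn
  obtain ⟨δ, hδ, H⟩ := Metric.uniformContinuousOn_iff.1 huc ε hε
  filter_upwards [ha, h, h1.eventually (Metric.ball_mem_nhds η hδ),
    h2.eventually (Metric.ball_mem_nhds p hδ)] with i g1 g2 g3 g4
  have q1 : a i ∈ Metric.closedBall (0 : Jet n) R' :=
    mem_closedBall_zero_iff.2 (g1.trans (le_max_left _ _))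
  have q2 : ((η, p, (a i).2.2) : Jet n) ∈ Metric.closedBall (0 : Jet n) R' := by
    rw [mem_closedBall_zero_iff, Prod.norm_def, Prod.norm_def]
    refine max_le ((le_max_left _ _).trans (le_max_right _ _)) (max_le
      ((le_max_right _ _).trans (le_max_right _ _)) ?_)
    exact ((norm_snd_le (a i).2).trans (norm_snd_le (a i))).trans (g1.trans (le_max_left _ _))
  have q3 : dist (a i) ((η, p, (a i).2.2) : Jet n) < δ := by
    rw [Prod.dist_eq, Prod.dist_eq]
    simp only [dist_self]
    exact max_lt g3 (max_lt g4 hδ)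
  have := H _ q1 _ q2 q3
  rw [Real.dist_eq, abs_lt] at this
  linarith [this.1]

/-! ### Weak limits in the Sobolev spaces. -/

/-- By Hahn–Banach every functional on the subspace extends to the ambient space. -/
theorem ConvWeakly.subtype {E : Type*} [NormedAddCommGroup E] [NormedSpace ℝ E]
    {S : Submodule ℝ E} {v : ℕ → S} {x : S} (h : ConvWeakly (fun j => (v j : E)) (x : E)) :
    ConvWeakly v x := by
  intro f
  obtain ⟨F, hF, -⟩ := exists_extension_norm_eq S f
  have h1 := h F
  simp only [hF] at h1
  exact h1

theorem ConvWeakly.tendsto_toWeakSpace {E : Type*} [NormedAddCommGroup E] [NormedSpace ℝ E]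
    {w : ℕ → E} {x : E} (h : ConvWeakly w x) :
    Tendsto (fun j => toWeakSpace ℝ E (w j)) atTop (𝓝 (toWeakSpace ℝ E x)) := by
  refine (WeakBilin.tendsto_iff_forall_eval_tendsto
    (B := (topDualPairing ℝ E).flip) ?_).2 h
  intro a b hab
  by_contra hne
  obtain ⟨f, hf⟩ := SeparatingDual.exists_separating_of_ne (R := ℝ) hne
  exact hf (LinearMap.congr_fun hab f)

section Lp

variable {α : Type*} [MeasurableSpace α] {μ : Measure α} {F : Type*} [NormedAddCommGroup F]
  [NormedSpace ℝ F]

theorem ConvWeakly.tendsto_toWeakSpace_Lp {p : ℝ≥0∞} [Fact (1 ≤ p)]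
    (S : Submodule ℝ (Lp F p μ)) (v : ℕ → S) (x : S)
    (h : ConvWeakly (fun j => (v j : Lp F p μ)) (x : Lp F p μ)) :
    Tendsto (fun j => toWeakSpace ℝ S (v j)) atTop (𝓝 (toWeakSpace ℝ S x)) :=
  ConvWeakly.tendsto_toWeakSpace (ConvWeakly.subtype h)

theorem ConvWeakly.of_L2_add [IsFiniteMeasure μ]
    {w : ℕ → Lp F 2 μ} {z : Lp F 2 μ} (h : ConvWeakly w z) {r : ℝ} (hr : 1 ≤ r)
    [Fact (1 ≤ ENNReal.ofReal r)] {B : ℝ≥0∞} (hB : B ≠ ∞)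
    (hw : ∀ᶠ j in atTop, eLpNorm (w j) (ENNReal.ofReal (2 * r - 1)) μ ≤ B)
    {u : ℕ → Lp F (ENNReal.ofReal r) μ} {uLim g : Lp F (ENNReal.ofReal r) μ}
    (hu : ∀ j, w j =ᵐ[μ] ⇑(u j) - ⇑g) (hu' : z =ᵐ[μ] ⇑uLim - ⇑g) : ConvWeakly u uLim := by
  have key : ConvWeakly (fun j => u j - g) (uLim - g) :=
    h.of_L2 hr hB hw (fun j => (Lp.coeFn_sub _ _).trans (hu j).symm)
      ((Lp.coeFn_sub _ _).trans hu'.symm)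
  have := key.sub_const (-g)
  simpa only [sub_neg_eq_add, sub_add_cancel] using this

/-- The inclusion of `L²` into `L^1` is weakly continuous, so the closed convex set `Z` of `L^1`
captures the limit; the differences then have the form required by the Rellich lemma. -/
theorem ConvWeakly.exists_limit_L1 [IsFiniteMeasure μ]
    {w : ℕ → Lp F 2 μ} {z : Lp F 2 μ} (h : ConvWeakly w z) {B : ℝ} (hB : ∀ j, ‖w j‖ ≤ B)
    {Z : Set (Lp F 1 μ)} (hZ : Convex ℝ Z) (hZ' : IsClosed Z) {f : ℕ → Lp F 1 μ}
    (hf : ∀ j, f j ∈ Z) (hfw : ∀ j, f j =ᵐ[μ] w j) :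
    ∃ f₀ ∈ Z, f₀ =ᵐ[μ] z ∧ ConvWeakly (fun j => f j - f₀) 0 ∧
      ∃ K : ℝ≥0, ∀ j, ∫⁻ x, ‖(f j - f₀) x‖ₑ ∂μ ≤ K := by
  have h12 : (1 : ℝ≥0∞) ≤ 2 := by norm_num
  have hI := coeFn_lpIncl μ F h12
  have hfI : ∀ j, f j = lpIncl μ F h12 (w j) := fun j => Lp.ext ((hfw j).trans (hI _).symm)
  have hIw : ConvWeakly f (lpIncl μ F h12 z) := by
    have := h.map (lpIncl μ F h12)
    simpa only [← hfI] using this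
  refine ⟨lpIncl μ F h12 z, hIw.mem_of_frequently hZ hZ'
    (Eventually.frequently (Eventually.of_forall hf)), hI z, ?_,
    (‖lpIncl μ F h12‖ * (B + ‖z‖)).toNNReal, fun j => ?_⟩
  · have := hIw.sub_const (lpIncl μ F h12 z)
    rwa [sub_self] at this
  · rw [← eLpNorm_one_eq_lintegral_enorm, ← Lp.enorm_def, hfI, ← map_sub, ← ofReal_norm]
    refine ENNReal.ofReal_le_ofReal (((lpIncl μ F h12).le_opNorm _).trans ?_)
    gcongr
    exact (norm_sub_le _ _).trans (by gcongr; exact hB j)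

end Lp

theorem IsWeakJet.congr {n : ℕ} {Ω : Set (Euc n)} {w w' : Euc n → Jet n} (h : IsWeakJet Ω w)
    (e : w' =ᵐ[volume.restrict Ω] w) : IsWeakJet Ω w' := by
  intro φ hφ
  obtain ⟨h1, h2⟩ := h φ hφ
  have key : ∀ (c : Jet n → ℝ) (ψ : Euc n → ℝ), ∫ x in Ω, c (w' x) * ψ x =
      ∫ x in Ω, c (w x) * ψ x := fun c ψ =>
    integral_congr_ae (by filter_upwards [e] with x hx; rw [hx])
  refine ⟨fun i => ?_, fun i j => ?_⟩
  · rw [key (fun z => z.1), h1, key (fun z => z.2.1 i)]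
  · rw [key (fun z => z.2.1 i), h2, key (fun z => z.2.2.1 (i, j))]

/-- The inclusion `W^{2,∞}(Ω) ⊆ W^{2,q}(Ω)`. -/
noncomputable def W2.incl {n : ℕ} {Ω : Set (Euc n)} [IsFiniteMeasure (volume.restrict Ω)]
    (q : ℝ≥0∞) [Fact (1 ≤ q)] (u : W2 Ω ∞) : W2 Ω q :=
  ⟨lpIncl (volume.restrict Ω) (Jet n) le_top u.1,
    u.2.congr (coeFn_lpIncl (volume.restrict Ω) (Jet n) le_top u.1)⟩

theorem weakConvW2_of_convWeakly {n : ℕ} {Ω : Set (Euc n)} [IsFiniteMeasure (volume.restrict Ω)]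
    {w : ℕ → Lp (Jet n) 2 (volume.restrict Ω)} {z : Lp (Jet n) 2 (volume.restrict Ω)}
    (h : ConvWeakly w z) {q : ℝ≥0∞} [Fact (1 ≤ q)] {r : ℝ} (hq : q = ENNReal.ofReal r)
    (hr : 1 ≤ r) {B : ℝ≥0∞} (hB : B ≠ ∞)
    (hw : ∀ᶠ j in atTop, eLpNorm (w j) (ENNReal.ofReal (2 * r - 1)) (volume.restrict Ω) ≤ B)
    {u : ℕ → W2 Ω ∞} {uLim g : W2 Ω ∞}
    (hu : ∀ j, w j =ᵐ[volume.restrict Ω] jet (u j) - jet g)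
    (hu' : z =ᵐ[volume.restrict Ω] jet uLim - jet g) : WeakConvW2 q u uLim := by
  subst hq
  have hinc : ∀ v : W2 Ω ∞, jet (W2.incl (ENNReal.ofReal r) v) =ᵐ[volume.restrict Ω] jet v :=
    fun v => coeFn_lpIncl (volume.restrict Ω) (Jet n) le_top v.1
  refine ⟨fun j => W2.incl _ (u j), W2.incl _ uLim, fun j => hinc _, hinc _, ?_⟩
  exact ConvWeakly.tendsto_toWeakSpace_Lp (W2 Ω (ENNReal.ofReal r)) _ _
    (h.of_L2_add hr hB hw (g := (W2.incl _ g).1)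
      (fun j => (hu j).trans ((hinc (u j)).sub (hinc g)).symm)
      (hu'.trans ((hinc uLim).sub (hinc g)).symm))

theorem exists_subseq_ae_tendsto {n : ℕ} {Ω : Set (Euc n)} (hΩ : IsOpen Ω)
    (hΩb : Bornology.IsBounded Ω) [IsFiniteMeasure (volume.restrict Ω)]
    {w : ℕ → Lp (Jet n) 2 (volume.restrict Ω)} {z : Lp (Jet n) 2 (volume.restrict Ω)}
    (h : ConvWeakly w z) {B : ℝ} (hB : ∀ j, ‖w j‖ ≤ B)
    (hw : ∀ j, ∃ v ∈ W2OneZero Ω, jet v =ᵐ[volume.restrict Ω] w j) :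
    (∃ v ∈ W2OneZero Ω, jet v =ᵐ[volume.restrict Ω] z) ∧
    ∃ l : ℕ → ℕ, StrictMono l ∧ ∀ᵐ x ∂volume.restrict Ω,
      Tendsto (fun i => (w (l i) x).1) atTop (𝓝 (z x).1) ∧
      Tendsto (fun i => (w (l i) x).2.1) atTop (𝓝 (z x).2.1) := by
  choose v hv hvw using hw
  obtain ⟨f₀, ⟨v₀, hv₀, rfl⟩, hv₀', hweak, K, hK⟩ := h.exists_limit_L1 hB
    (convex_image_W2OneZero Ω) (isClosed_image_W2OneZero Ω) (f := fun j => (v j).1)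
    (fun j => ⟨v j, hv j, rfl⟩) hvw
  refine ⟨⟨v₀, hv₀, hv₀'⟩, ?_⟩
  have hR := tendsto_lintegral_of_convWeakly hΩ hΩb (fun j => sub_mem_W2OneZero (hv j) hv₀)
    hK hweak
  let δ : ℕ → Euc n → ℝ × Euc n := fun j x => ((jet (v j - v₀) x).1, (jet (v j - v₀) x).2.1)
  have hδm : ∀ j, StronglyMeasurable (δ j) := fun j =>
    (stronglyMeasurable_jet (v j - v₀)).fst.prodMk (stronglyMeasurable_jet (v j - v₀)).snd.fst
  have hδ : Tendsto (fun j => eLpNorm (δ j - 0) 1 (volume.restrict Ω)) atTop (𝓝 0) := by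
    refine tendsto_of_tendsto_of_tendsto_of_le_of_le tendsto_const_nhds hR (fun _ => zero_le)
      fun j => ?_
    simp only [sub_zero]
    rw [eLpNorm_one_eq_lintegral_enorm]
    refine lintegral_mono fun x => ?_
    simp only [δ, ← ofReal_norm]
    rw [← ENNReal.ofReal_add (norm_nonneg _) (norm_nonneg _)]
    exact ENNReal.ofReal_le_ofReal (by
      rw [Prod.norm_def]
      exact max_le_add_of_nonneg (norm_nonneg _) (norm_nonneg _))
  obtain ⟨l, hl, hlt⟩ := (tendstoInMeasure_of_tendsto_eLpNorm one_ne_zero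
    (fun j => (hδm j).aestronglyMeasurable) aestronglyMeasurable_const hδ).exists_seq_tendsto_ae
  refine ⟨l, hl, ?_⟩
  have hae : ∀ᵐ x ∂volume.restrict Ω, ∀ j, jet (v j - v₀) x = w j x - z x := by
    refine ae_all_iff.2 fun j => ?_
    filter_upwards [hvw j, hv₀', Lp.coeFn_sub (v j).1 v₀.1] with x h1 h2 h3
    rw [← h1, ← h2]
    exact h3
  filter_upwards [hlt, hae] with x h1 h2
  have h3 := (continuous_fst.tendsto _).comp h1
  have h4 := (continuous_snd.tendsto _).comp h1
  simp only [Function.comp_def, δ, h2, Prod.fst_sub, Prod.snd_sub] at h3 h4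
  exact ⟨by simpa using h3.add_const (z x).1, by simpa using h4.add_const (z x).2.1⟩

theorem eLpNorm_le_mul_one_add_measure {α : Type*} [MeasurableSpace α] {μ : Measure α}
    {F : Type*} [NormedAddCommGroup F] {f : α → F} (hf : AEStronglyMeasurable f μ) {r s : ℝ}
    (hr : 1 ≤ r) (hrs : r ≤ s) :
    eLpNorm f (ENNReal.ofReal r) μ ≤ eLpNorm f (ENNReal.ofReal s) μ * (1 + μ Set.univ) := by
  have hr0 : 0 < r := by linarith
  refine (eLpNorm_le_eLpNorm_mul_rpow_measure_univ (ENNReal.ofReal_le_ofReal hrs) hf).trans ?_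
  rw [ENNReal.toReal_ofReal hr0.le, ENNReal.toReal_ofReal (hr0.le.trans hrs)]
  gcongr
  refine ENNReal.rpow_le_one_add (sub_nonneg.2 (one_div_le_one_div_of_le hr0 hrs)) ?_
  have h1 : 1 / r ≤ 1 := (div_le_one hr0).2 hr
  have h2 : 0 ≤ 1 / s := by have := hr0.trans_le hrs; positivity
  linarith

theorem add_mem_W2InfAffine_self {n : ℕ} {Ω : Set (Euc n)} {g z : W2 Ω ∞}
    (hz : z ∈ W2InfZero Ω) : z + g ∈ W2InfAffine g := by
  rw [add_comm]
  exact add_mem_W2InfAffine (self_mem_W2InfAffine g) hz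

/-- Bounds on jets in `L^p` with `p → ∞` give a subsequence that converges weakly in all
`W^{2,q}(Ω)` to an element of `W^{2,∞}(Ω)`. -/
theorem exists_subseq_weakConvW2 {n : ℕ} {Ω : Set (Euc n)} (hΩ : IsOpen Ω)
    (hΩb : Bornology.IsBounded Ω) {g : W2 Ω ∞} {U : ℕ → W2 Ω ∞} (hU : ∀ j, U j ∈ W2InfAffine g)
    {B : ℝ≥0} (hB : ∀ j : ℕ, eLpNorm (jet (U j - g)) (ENNReal.ofReal ((j : ℝ) + 2))
      (volume.restrict Ω) ≤ B) :
    ∃ uInf ∈ W2InfAffine g, ∃ k : ℕ → ℕ, StrictMono k ∧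
      (∀ (q : ℝ≥0∞) [Fact (1 ≤ q)], 1 < q → q < ∞ → WeakConvW2 q (fun j => U (k j)) uInf) ∧
      ∃ l : ℕ → ℕ, StrictMono l ∧ ∃ (w : ℕ → Lp (Jet n) 2 (volume.restrict Ω))
        (z : Lp (Jet n) 2 (volume.restrict Ω)) (R : ℝ), ConvWeakly w z ∧
        (∀ i, w i =ᵐ[volume.restrict Ω] jet (U (l i)) - jet g) ∧
        z =ᵐ[volume.restrict Ω] jet uInf - jet g ∧
        (∀ᵐ x ∂volume.restrict Ω, ∀ᶠ i in atTop, ‖w i x‖ ≤ R) ∧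
        ∀ᵐ x ∂volume.restrict Ω, Tendsto (fun i => (w i x).1) atTop (𝓝 (z x).1) ∧
          Tendsto (fun i => (w i x).2.1) atTop (𝓝 (z x).2.1) := by
  have hfin : IsFiniteMeasure (volume.restrict Ω) := ⟨by simpa using hΩb.measure_lt_top⟩
  have hsub : ∀ u : W2 Ω ∞, jet (u - g) =ᵐ[volume.restrict Ω] jet u - jet g := fun u =>
    Lp.coeFn_sub u.1 g.1
  obtain ⟨w, hw⟩ : ∃ w : ℕ → Lp (Jet n) 2 (volume.restrict Ω),
      ∀ j, w j =ᵐ[volume.restrict Ω] jet (U j - g) :=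
    ⟨fun j => (W2.incl 2 (U j - g)).1,
      fun j => coeFn_lpIncl (volume.restrict Ω) (Jet n) le_top (U j - g).1⟩
  have hw' : ∀ j, w j =ᵐ[volume.restrict Ω] jet (U j) - jet g := fun j => (hw j).trans (hsub _)
  have hV : (1 + (volume.restrict Ω) Set.univ) ≠ ∞ := by simp [hΩb.measure_lt_top.ne]
  have hwr : ∀ (j : ℕ) (r : ℝ), 1 ≤ r → r ≤ (j : ℝ) + 2 →
      eLpNorm (w j) (ENNReal.ofReal r) (volume.restrict Ω) ≤
        B * (1 + (volume.restrict Ω) Set.univ) := by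
    intro j r hr hrj
    refine (eLpNorm_le_mul_one_add_measure (Lp.aestronglyMeasurable _) hr hrj).trans ?_
    rw [eLpNorm_congr_ae (hw j)]
    gcongr
    exact hB j
  have hnorm : ∀ j, ‖w j‖ ≤ (B * (1 + (volume.restrict Ω) Set.univ)).toReal := by
    intro j
    rw [Lp.norm_def]
    refine ENNReal.toReal_mono (ENNReal.mul_ne_top (by simp) hV) ?_
    have := hwr j 2 (by norm_num) (by linarith [(Nat.cast_nonneg j : (0 : ℝ) ≤ j)])
    rwa [ENNReal.ofReal_ofNat] at this
  obtain ⟨z, k, hk, hz⟩ := exists_convWeakly_L2 w _ hnorm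
  have hmem : ∀ j, ∃ v ∈ W2OneZero Ω, jet v =ᵐ[volume.restrict Ω] w j := by
    intro j
    obtain ⟨v, hv, hv'⟩ := hU j
    exact ⟨v, hv, hv'.trans (hw j).symm⟩
  obtain ⟨⟨v₀, hv₀, hv₀z⟩, l, hl, hlt⟩ := exists_subseq_ae_tendsto hΩ hΩb hz
    (fun j => hnorm (k j)) (fun j => hmem (k j))
  have hbd : ∀ᵐ x ∂volume.restrict Ω, ∀ᶠ j in atTop, ‖w j x‖ ≤ (B : ℝ) + 2 := by
    -- Borel–Cantelli with levels `B + 1 < B + 2`; the shift makes the lower level positive even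
    -- when `B = 0`.
    have h1 := ae_eventually_lt_of_lintegral_rpow_le (μ := volume.restrict Ω)
      (f := fun j x => ‖w j x‖ₑ) (fun j => (Lp.stronglyMeasurable (w j)).enorm.aemeasurable)
      (V := 1) ENNReal.one_ne_top (a := B + 1) (b := B + 2) (by positivity) (by linarith)
      (Eventually.of_forall fun j => by
        have hp : 0 < (j : ℝ) + 2 := by positivity
        have h2 := hB j
        rw [← eLpNorm_congr_ae (hw j),
          eLpNorm_eq_lintegral_rpow_enorm_toReal (by simpa using hp) (by simp),
          ENNReal.toReal_ofReal hp.le, one_div, ENNReal.rpow_inv_le_iff hp] at h2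
        rw [one_mul]
        refine h2.trans (ENNReal.rpow_le_rpow ?_ hp.le)
        rw [← ENNReal.ofReal_coe_nnreal]
        exact ENNReal.ofReal_le_ofReal (by linarith))
    filter_upwards [h1] with x hx
    filter_upwards [hx] with j hj
    rw [← ofReal_norm] at hj
    exact (ENNReal.ofReal_lt_ofReal_iff (by positivity)).1 hj |>.le
  have hzb : ∀ᵐ x ∂volume.restrict Ω, ‖z x‖ ≤ (B : ℝ) + 2 := by
    have := hz.ae_mem (C := fun _ => Metric.closedBall 0 ((B : ℝ) + 2))
      (Eventually.of_forall fun _ => convex_closedBall _ _)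
      (Eventually.of_forall fun _ => Metric.isClosed_closedBall) (by
        filter_upwards [hbd] with x hx
        filter_upwards [hk.tendsto_atTop.eventually hx] with j hj
        exact mem_closedBall_zero_iff.2 hj)
    filter_upwards [this] with x hx
    exact mem_closedBall_zero_iff.1 hx
  have hzL : MemLp z ∞ (volume.restrict Ω) :=
    memLp_top_of_bound (Lp.aestronglyMeasurable _) _ hzb
  -- Boundedness comes from the pointwise bounds, and the weak derivative identities from the
  -- `W^{2,1}_0` representative `v₀` of the same limit.
  obtain ⟨zInf, hzInf⟩ : ∃ zInf : W2 Ω ∞, jet zInf =ᵐ[volume.restrict Ω] z :=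
    ⟨⟨hzL.toLp z, v₀.2.congr (hzL.coeFn_toLp.trans hv₀z.symm)⟩, hzL.coeFn_toLp⟩
  have hzg : z =ᵐ[volume.restrict Ω] jet (zInf + g) - jet g := by
    have := hsub (zInf + g)
    rw [add_sub_cancel_right] at this
    exact hzInf.symm.trans this
  have c1 : zInf + g ∈ W2InfAffine g := add_mem_W2InfAffine_self ⟨v₀, hv₀, hv₀z.trans hzInf.symm⟩
  have c2 : ∀ (q : ℝ≥0∞) [Fact (1 ≤ q)], 1 < q → q < ∞ →
      WeakConvW2 q (fun j => U (k j)) (zInf + g) := by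
    intro q _ hq1 hq2
    have hr : 1 ≤ q.toReal := by
      rw [← ENNReal.toReal_one]
      exact ENNReal.toReal_mono hq2.ne hq1.le
    have hbr : ∀ᶠ j in atTop, eLpNorm ((w ∘ k) j) (ENNReal.ofReal (2 * q.toReal - 1))
        (volume.restrict Ω) ≤ B * (1 + (volume.restrict Ω) Set.univ) := by
      -- Once `k j ≥ 2q`, the bound in `L^{k j + 2}` controls the `L^{2q-1}` norm on the bounded set
      -- `Ω`.
      filter_upwards [eventually_ge_atTop (⌈2 * q.toReal⌉₊)] with j hj
      refine hwr (k j) _ (by linarith) ?_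
      have h1 : ((⌈2 * q.toReal⌉₊ : ℕ) : ℝ) ≤ (k j : ℝ) := by exact_mod_cast hj.trans (hk.id_le j)
      linarith [Nat.le_ceil (2 * q.toReal)]
    exact weakConvW2_of_convWeakly hz (r := q.toReal) (ENNReal.ofReal_toReal hq2.ne).symm hr
      (ENNReal.mul_ne_top (by simp) hV) hbr (g := g) (fun j => hw' (k j)) hzg
  have c3 : ∀ᵐ x ∂volume.restrict Ω, ∀ᶠ i in atTop, ‖(w ∘ k ∘ l) i x‖ ≤ (B : ℝ) + 2 := by
    filter_upwards [hbd] with x hx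
    exact (hk.comp hl).tendsto_atTop.eventually hx
  have c4 : ConvWeakly (w ∘ k ∘ l) z := hz.comp hl
  have c5 : ∀ i, (w ∘ k ∘ l) i =ᵐ[volume.restrict Ω] jet (U ((k ∘ l) i)) - jet g := fun i => hw' _
  exact ⟨zInf + g, c1, k, hk, c2, k ∘ l, hk.comp hl, w ∘ k ∘ l, z, (B : ℝ) + 2, c4, c5, hzg, c3,
    hlt⟩

/-! ### Lower semicontinuity and existence of the minimiser. -/

/-- Lower semicontinuity: eventual pointwise upper bounds on the supremand pass to the limit. -/
theorem EInf_le_of_eventually_le {n : ℕ} {Ω : Set (Euc n)} (hΩ : IsOpen Ω)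
    {H : Euc n → ℝ → Euc n → SymMat n → ℝ} (hH_car : IsCaratheodory Ω H)
    (hH_level : ∀ x ∈ Ω, ∀ η p (τ : ℝ), Convex ℝ {X : SymMat n | H x η p X ≤ τ})
    {g u : W2 Ω ∞} {V : ℕ → W2 Ω ∞} {w : ℕ → Lp (Jet n) 2 (volume.restrict Ω)}
    {z : Lp (Jet n) 2 (volume.restrict Ω)} {R : ℝ} (hwz : ConvWeakly w z)
    (hw : ∀ i, w i =ᵐ[volume.restrict Ω] jet (V i) - jet g)
    (hz : z =ᵐ[volume.restrict Ω] jet u - jet g)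
    (hR : ∀ᵐ x ∂volume.restrict Ω, ∀ᶠ i in atTop, ‖w i x‖ ≤ R)
    (hlim : ∀ᵐ x ∂volume.restrict Ω, Tendsto (fun i => (w i x).1) atTop (𝓝 (z x).1) ∧
      Tendsto (fun i => (w i x).2.1) atTop (𝓝 (z x).2.1))
    {c ε : ℝ} (hε : 0 < ε)
    (h : ∀ᵐ x ∂volume.restrict Ω, ∀ᶠ i in atTop, supremand H (V i) x ≤ c) :
    EInf H u ≤ ((c + ε : ℝ) : EReal) := by
  rw [EInf_le_iff]
  -- The weakly convergent jets are those of `V i - g`, so the Hessian of `g` is added back; the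
  -- lower-order arguments are those of the limit `u`. Only the Hessian variable remains, and
  -- level-convexity makes `C x` convex.
  let C : Euc n → Set (Jet n) := fun x =>
    {y | H x (jet u x).1 (jet u x).2.1 (y.2.2 + (jet g x).2.2) ≤ c + ε}
  have key : ∀ᵐ x ∂volume.restrict Ω, z x ∈ C x := by
    refine hwz.ae_mem ?_ ?_ ?_
    · filter_upwards [ae_restrict_mem hΩ.measurableSet] with x hx
      intro y₁ hy₁ y₂ hy₂ a b ha hb hab
      have := hH_level x hx (jet u x).1 (jet u x).2.1 (c + ε) hy₁ hy₂ ha hb hab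
      have e : (a • y₁ + b • y₂).2.2 + (jet g x).2.2 =
          a • (y₁.2.2 + (jet g x).2.2) + b • (y₂.2.2 + (jet g x).2.2) := by
        rw [smul_add, smul_add, add_add_add_comm, ← add_smul, hab, one_smul]
        rfl
      change H x _ _ ((a • y₁ + b • y₂).2.2 + (jet g x).2.2) ≤ c + ε
      rw [e]
      exact this
    · filter_upwards [hH_car.2] with x hx
      have hc : Continuous fun y : Jet n =>
          H x (jet u x).1 (jet u x).2.1 (y.2.2 + (jet g x).2.2) :=
        hx.comp (f := fun y : Jet n =>
          ((jet u x).1, (jet u x).2.1, y.2.2 + (jet g x).2.2)) (by fun_prop)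
      exact isClosed_le hc continuous_const
    · filter_upwards [hH_car.2, ae_all_iff.2 hw, hz, hR, hlim, h] with x h1 h2 h3 h4 h5 h6
      have e : ∀ i, jet (V i) x = w i x + jet g x := fun i => by
        rw [h2 i, Pi.sub_apply, sub_add_cancel]
      have eu : jet u x = z x + jet g x := by rw [h3, Pi.sub_apply, sub_add_cancel]
      have h7 := eventually_le_freeze h1 (a := fun i => jet (V i) x) (R := R + ‖jet g x‖)
        (by
          filter_upwards [h4] with i hi
          rw [e]
          exact (norm_add_le _ _).trans (by gcongr))
        (η := (jet u x).1) (p := (jet u x).2.1)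
        (by simp only [e, eu, Prod.fst_add]; exact h5.1.add_const _)
        (by simp only [e, eu, Prod.fst_add, Prod.snd_add]; exact h5.2.add_const _) hε h6
      filter_upwards [h7] with i hi
      rw [e] at hi
      exact hi
  filter_upwards [key, hz] with x h1 h2
  have eu : (jet u x).2.2 = (z x).2.2 + (jet g x).2.2 := by
    rw [h2, Pi.sub_apply, Prod.snd_sub, Prod.snd_sub, sub_add_cancel]
  change H x _ _ _ ≤ c + ε
  rw [eu]
  exact h1

theorem W2.eq_of_volume_eq_zero {n : ℕ} {Ω : Set (Euc n)} (h : volume Ω = 0) (u v : W2 Ω ∞) :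
    u = v := by
  refine Subtype.ext (Lp.ext (ae_iff.2 (le_antisymm
    ((measure_mono (Set.subset_univ _)).trans ?_) zero_le)))
  simp [h]

theorem exists_minimiser_of_lt_top {n : ℕ} (hn : 1 ≤ n) {Ω : Set (Euc n)} (hΩ : IsOpen Ω)
    (hΩb : Bornology.IsBounded Ω) {H : Euc n → ℝ → Euc n → SymMat n → ℝ}
    (hH_car : IsCaratheodory Ω H) {m M : ℝ}
    (hH_below : ∀ x ∈ Ω, ∀ η p X, -m ≤ H x η p X) (hM : m < M)
    (hH_level : ∀ x ∈ Ω, ∀ η p (τ : ℝ), Convex ℝ {X : SymMat n | H x η p X ≤ τ})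
    (hH_coercive : ∃ C₁ > (0 : ℝ), ∃ C₂ > (0 : ℝ), ∃ s t : ℝ, 0 ≤ s ∧ s < 1 ∧ 0 ≤ t ∧ t < 1 ∧
      ∀ᵐ x ∂volume.restrict Ω, ∀ (η : ℝ) (p : Euc n) (X : SymMat n),
        C₁ * ‖X‖ - C₂ * (1 + |η| ^ s + ‖p‖ ^ t) ≤ H x η p X) {g v₀ : W2 Ω ∞}
    (hv₀ : v₀ ∈ W2InfAffine g) (hv₀' : EInf H v₀ < ⊤) :
    ∃ uInf : W2 Ω ∞, IsGlobalMinimiser H g uInf ∧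
      ∃ u : ℝ → W2 Ω ∞, (∀ p : ℝ, 1 < p → IsApproxMinimiser H M p g (u p)) ∧
        ∃ P : ℕ → ℝ, (∀ j, 1 < P j) ∧ Tendsto P atTop atTop ∧
          ∀ (q : ℝ≥0∞) [Fact (1 ≤ q)], 1 < q → q < ∞ →
            WeakConvW2 q (fun j => u (P j)) uInf := by
  have hfin : IsFiniteMeasure (volume.restrict Ω) := ⟨by simpa using hΩb.measure_lt_top⟩
  have hVt : volume Ω ≠ ∞ := hΩb.measure_lt_top.ne
  choose! U hU using fun (p : ℝ) (hp : 1 < p) =>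
    exists_isApproxMinimiser H (M := M) (zero_lt_one.trans hp) hv₀ hv₀'
  -- On a null set all elements of `W^{2,∞}` coincide, so every claim is trivial; otherwise the
  -- averages in `E_p` are genuine.
  by_cases hV : volume Ω = 0
  · refine ⟨g, ⟨self_mem_W2InfAffine g, fun φ _ => ?_⟩, U, hU, fun j => (j : ℝ) + 2, fun j => ?_,
      tendsto_natCast_atTop_atTop.atTop_add tendsto_const_nhds, fun q _ _ _ => ?_⟩
    · rw [W2.eq_of_volume_eq_zero hV (g + φ) g]
    · linarith [(Nat.cast_nonneg j : (0 : ℝ) ≤ j)]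
    · have hinc : ∀ v, jet (W2.incl q g) =ᵐ[volume.restrict Ω] jet v := fun v => by
        rw [W2.eq_of_volume_eq_zero hV v g]
        exact coeFn_lpIncl (volume.restrict Ω) (Jet n) le_top g.1
      exact ⟨fun _ => W2.incl q g, W2.incl q g, fun j => hinc _, hinc _, tendsto_const_nhds⟩
  have hjp : ∀ j : ℕ, 1 < (j : ℝ) + 2 := fun j => by
    linarith [(Nat.cast_nonneg j : (0 : ℝ) ≤ j)]
  -- The strict inequality `m < M` gives `M + c > 0`, the positive level that Borel–Cantelli needs.
  have hlow : ∀ {v : W2 Ω ∞} {c : ℝ}, EInf H v ≤ (c : EReal) → -M < c := by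
    intro v c h
    have : NeZero (volume.restrict Ω) := ⟨by rwa [Ne, Measure.restrict_eq_zero]⟩
    obtain ⟨x, hx1, hx2⟩ := ((EInf_le_iff.1 h).and (ae_restrict_mem hΩ.measurableSet)).exists
    have := hH_below x hx2 (jet v x).1 (jet v x).2.1 (jet v x).2.2
    have h3 : H x (jet v x).1 (jet v x).2.1 (jet v x).2.2 ≤ c := hx1
    linarith
  have hint : ∀ {v : W2 Ω ∞} {c : ℝ}, v ∈ W2InfAffine g → EInf H v ≤ (c : EReal) →
      ∀ (j : ℕ) (ε : ℝ), (2 : ℝ) ^ (-((j : ℝ) + 2)) ≤ ε →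
      ∫⁻ x in Ω, ENNReal.ofReal (M + supremand H (U ((j : ℝ) + 2)) x) ^ ((j : ℝ) + 2) ≤
        volume Ω * ENNReal.ofReal (M + (c + ε)) ^ ((j : ℝ) + 2) := by
    intro v c hv hc j ε hε
    have hp : 0 < (j : ℝ) + 2 := zero_lt_one.trans (hjp j)
    have h2 : 0 < (2 : ℝ) ^ (-((j : ℝ) + 2)) := Real.rpow_pos_of_pos two_pos _
    have hc' := hlow hc
    refine lintegral_le_of_EPow_le hV hVt hp (by linarith)
      (((hU _ (hjp j)).EPow_le hp hc'.le hv hc).trans ?_)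
    exact EReal.coe_le_coe_iff.2 (by linarith)
  obtain ⟨c₀, hc₀⟩ : ∃ c : ℝ, EInf H v₀ ≤ c := by
    obtain ⟨c, h1, -⟩ := EReal.lt_iff_exists_real_btwn.1 hv₀'
    exact ⟨c, h1.le⟩
  obtain ⟨B, hB⟩ := exists_uniform_bound hn hΩ hΩb hH_car hH_below hM hH_coercive g (M + (c₀ + 1))
  have hUmem : ∀ j : ℕ, U ((j : ℝ) + 2) ∈ W2InfAffine g := fun j => (hU _ (hjp j)).1
  obtain ⟨uInf, huInf, k, hk, hconv, l, hl, w, z, R, hwz, hw, hz, hR, hlim⟩ :=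
    exists_subseq_weakConvW2 hΩ hΩb (U := fun j : ℕ => U ((j : ℝ) + 2)) hUmem (fun j =>
      hB _ (hjp j).le _ (hUmem j) (hint hv₀ hc₀ j 1 (by
        refine Real.rpow_le_one_of_one_le_of_nonpos one_le_two ?_
        linarith [hjp j])))
  have hmin : ∀ v ∈ W2InfAffine g, EInf H uInf ≤ EInf H v := by
    intro v hv
    by_contra hcon
    obtain ⟨c, hc1, hc2⟩ := EReal.lt_iff_exists_real_btwn.1 (not_le.1 hcon)
    obtain ⟨c', hc3, hc4⟩ := EReal.lt_iff_exists_real_btwn.1 hc2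
    have hcc : c < c' := EReal.coe_lt_coe_iff.1 hc3
    -- The gap is spent in thirds: on the tolerance `2^{-p}`, on the strict level gap in
    -- Borel–Cantelli, and on freezing the lower-order arguments.
    set ε := (c' - c) / 3 with hε
    have hε0 : 0 < ε := by rw [hε]; linarith
    have hsmall : ∀ᶠ j : ℕ in atTop, (2 : ℝ) ^ (-((j : ℝ) + 2)) ≤ ε := by
      have h1 : Tendsto (fun j : ℕ => (2 : ℝ) ^ (-((j : ℝ) + 2))) atTop (𝓝 0) := by
        have h2 := (tendsto_rpow_atBot_of_base_gt_one 2 one_lt_two).comp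
          (tendsto_neg_atTop_atBot.comp ((tendsto_natCast_atTop_atTop (R := ℝ)).atTop_add
            (tendsto_const_nhds (x := (2 : ℝ)))))
        exact h2
      filter_upwards [h1.eventually (gt_mem_nhds hε0)] with j hj using hj.le
    have hlowc := hlow hc1.le
    have hev := ae_eventually_lt_of_lintegral_rpow_le (μ := volume.restrict Ω)
      (f := fun j x => ENNReal.ofReal (M + supremand H (U ((j : ℝ) + 2)) x))
      (fun j => ((hH_car.aemeasurable_supremand _).const_add M).ennreal_ofReal) hVt
      (a := M + (c + ε)) (b := M + (c + 2 * ε)) (by linarith) (by linarith)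
      (hsmall.mono fun j hj => hint hv hc1.le j ε hj)
    refine absurd (EInf_le_of_eventually_le hΩ hH_car hH_level hwz hw hz hR hlim
      (c := c + 2 * ε) hε0 ?_) (not_le.2 ?_)
    · filter_upwards [hev] with x hx
      filter_upwards [hl.tendsto_atTop.eventually hx] with i hi
      have := (ENNReal.ofReal_lt_ofReal_iff (by linarith)).1 hi
      linarith
    · have e : c + 2 * ε + ε = c' := by rw [hε]; ring
      rwa [e]
  refine ⟨uInf, ⟨huInf, fun φ hφ => hmin _ (add_mem_W2InfAffine huInf hφ)⟩, U, hU,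
    fun j => (k j : ℝ) + 2, fun j => hjp _, ?_, hconv⟩
  exact (tendsto_natCast_atTop_atTop.comp hk.tendsto_atTop).atTop_add tendsto_const_nhds

theorem mainTheorem1 (n : ℕ) (hn : 1 ≤ n) (Ω : Set (Euc n)) (hΩ_open : IsOpen Ω)
    (hΩ_bdd : Bornology.IsBounded Ω) (hΩ_lip : HasLipschitzBoundary Ω)
    (H : Euc n → ℝ → Euc n → SymMat n → ℝ) (hH_car : IsCaratheodory Ω H)
    -- boundedness below, and the constant of the modified functionals
    (m M : ℝ) (hm : 0 < m) (hH_below : ∀ x ∈ Ω, ∀ η p X, -m ≤ H x η p X) (hM : m < M)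
    -- level-convexity in the Hessian argument
    (hH_level : ∀ x ∈ Ω, ∀ η p (τ : ℝ), Convex ℝ {X : SymMat n | H x η p X ≤ τ})
    -- coercivity
    (hH_coercive : ∃ C₁ > (0 : ℝ), ∃ C₂ > (0 : ℝ), ∃ s t : ℝ, 0 ≤ s ∧ s < 1 ∧ 0 ≤ t ∧ t < 1 ∧
      ∀ᵐ x ∂volume.restrict Ω, ∀ (η : ℝ) (p : Euc n) (X : SymMat n),
        C₁ * ‖X‖ - C₂ * (1 + |η| ^ s + ‖p‖ ^ t) ≤ H x η p X)
    -- continuity in the lower-order arguments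
    (hH_cont : ∀ R > (0 : ℝ), ∃ l > (1 : ℝ), ∃ ω : ℝ → ℝ,
      ContinuousOn ω (Set.Ici 0) ∧ MonotoneOn ω (Set.Ici 0) ∧ ω 0 = 0 ∧
      ∀ᵐ x ∂volume.restrict Ω, ∀ (η' η'' : ℝ) (p' p'' : Euc n) (X : SymMat n),
        |η'| < R → |η''| < R → ‖p'‖ < R → ‖p''‖ < R →
          |H x η' p' X - H x η'' p'' X| ≤ ω (|η' - η''| + ‖p' - p''‖) * (1 + ‖X‖ ^ l))
    (g : W2 Ω ∞) :
    ∃ uInf : W2 Ω ∞, IsGlobalMinimiser H g uInf ∧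
      ((∃ v ∈ W2InfAffine g, EInf H v < ⊤) →
        ∃ u : ℝ → W2 Ω ∞, (∀ p : ℝ, 1 < p → IsApproxMinimiser H M p g (u p)) ∧
          ∃ P : ℕ → ℝ, (∀ j, 1 < P j) ∧ Tendsto P atTop atTop ∧
            ∀ (q : ℝ≥0∞) [Fact (1 ≤ q)], 1 < q → q < ∞ →
              WeakConvW2 q (fun j => u (P j)) uInf) := by
  by_cases h : ∃ v ∈ W2InfAffine g, EInf H v < ⊤
  · obtain ⟨v, hv, hv'⟩ := h
    obtain ⟨uInf, h1, h2⟩ := exists_minimiser_of_lt_top hn hΩ_open hΩ_bdd hH_car hH_below hM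
      hH_level hH_coercive hv hv'
    exact ⟨uInf, h1, fun _ => h2⟩
  -- The energy is `+∞` throughout the class, so `g` itself is a minimiser.
  · refine ⟨g, ⟨self_mem_W2InfAffine g, fun φ hφ => ?_⟩, fun h' => absurd h' h⟩
    have := h ∘ fun h' => ⟨g + φ, add_mem_W2InfAffine (self_mem_W2InfAffine g) hφ, h'⟩
    exact le_top.trans (not_lt.1 this)
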